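/- Write $N=\mathbb Z^2$ and $M=\operatorname{Hom}(N,\mathbb Z)$. A tropical isomorphism of $\mathbb R^2$ is a map $x\mapsto Ax+b$ with $A\in \mathrm{GL}_2(\mathbb Z)$, $b\in\mathbb R^2$. Let $\Phi\subset\mathbb R^2$ be closed and convex. A (rational) support half-plane of $\Phi$ is a half-plane $H=\{p:\lambda(p)\ge c\}$ with $\lambda\in M$ primitive and $c\in\mathbb R$ such that $\Phi\subset H$ and $\partial H\cap\partial\Phi\ne\emptyset$; put $H(t)=\{p:\lambda(p)\ge c+t\}$. Call $\Phi$ admissible if it has at least one such half-plane, and let $\Phi(t)=\bigcap_H H(t)$ for $t\ge 0$, the intersection being over all rational support half-planes of $\Phi$. The final time $t_\Phi\in[0,\infty]$ is the least $t\ge 0$ for which $\Phi(t)$ has empty interior ($\infty$ if there is none). If $t_\Phi<\infty$, then $\Phi(t_\Phi)$ is the final locus. The caustic $\mathcal K_\Phi$ is the set of all vertices of the polygonal domains $\Phi(t)$, $0<t<t_\Phi$, together with the final locus if $t_\Phi<\infty$. It carries weights: a vertex $v$ of $\Phi(t)$, $0<t<t_\Phi$, has weight $d$ if the dual cone $\{m\in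 M\otimes\mathbb R: m(x-v)\ge 0\ \forall x\in\Phi(t)\}$ is generated by primitive vectors $\lambda,\mu\in M$ with $|\det(\lambda,\mu)|=d\ge 1$ and $\lambda-\mu\in dM$ (an $A_{d-1}$-cone); the points of the final locus have weight $2$. A reflexive polygon is a lattice polygon $P$ with exactly one lattice point $o$ in its interior. Its dual polygon is $P^*=\{m\in M\otimes\mathbb R: m(x-o)\ge -1\ \forall x\in P\}$, and the side of $P^*$ dual to a vertex $v$ of $P$ is $\{m\in P^*: m(v-o)=-1\}$. **Proposition.** 1. Up to tropical isomorphism there are exactly 16 reflexive polygons; that is, there are pairwise non-isomorphic reflexive polygons $P_1,\dots,P_{16}$ such that every reflexive polygon is tropically isomorphic to one of them. 2. For every reflexive polygon $P$ with interior lattice point $o$, the caustic $\mathcal K_P$ is the union of the half-open segments $[o,v)$ over all vertices $v$ of $P$, and every point of the open segment $(o,v)$ has as its only weight the lattice length of the side of $P^*$ dual to $v$. 3. Let $\Phi$ be an admissible domain with non-empty interior whose final locus is a single point $p$. Then $p$ is a vertex of $\mathcal K_\Phi$ (that is, $p\in\mathcal K_\Phi$, and in no neighbourhood of $p$ does $\mathcal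 K_\Phi$ coincide with a straight line through $p$). Moreover, with $P_1,\dots,P_{16}$ as in 1, there are a polygon $P=P_i$ with interior lattice point $o$, a tropical isomorphism $f$ with $f(p)=o$, and an open neighbourhood $U$ of $p$ such that $f(\mathcal K_\Phi\cap U)=\mathcal K_P\cap f(U)$ and $f$ preserves the weights of the points of $\mathcal K_\Phi\cap U$. -/

import Mathlib

open Set Matrix

namespace TropicalPlane

/-- The real plane `ℝ² = ℤ² ⊗ ℝ`. The dual plane is identified with it through the
dot product, so that the dual lattice is again `ℤ²`. -/
abbrev Plane : Type := Fin 2 → ℝ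

/-- A lattice vector, viewed in the real plane. -/
def toPlane (z : Fin 2 → ℤ) : Plane := fun i => (z i : ℝ)

/-- A lattice vector is primitive if it is nonzero and not a proper multiple of a
lattice vector. -/
def Primitive (z : Fin 2 → ℤ) : Prop := Int.gcd (z 0) (z 1) = 1

/-- Tropical isomorphisms: a matrix in `GL₂(ℤ)` followed by a real translation. -/
def IsTropicalIso (f : Plane → Plane) : Prop :=
  ∃ (A : GL (Fin 2) ℤ) (b : Plane),
    ∀ x, f x = ((A : Matrix (Fin 2) (Fin 2) ℤ).map (Int.cast : ℤ → ℝ)) *ᵥ x + b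

/-- The closed half-plane `{p : c ≤ l(p)}` with slope `l`. -/
def halfPlane (l : Fin 2 → ℤ) (c : ℝ) : Set Plane := {p | c ≤ toPlane l ⬝ᵥ p}

/-- The half-plane with slope `l` and constant `c` is a support half-plane of `Φ` of rational
slope: it contains `Φ` and its boundary line meets the boundary of `Φ`. -/
def IsSupport (Φ : Set Plane) (l : Fin 2 → ℤ) (c : ℝ) : Prop :=
  Primitive l ∧ Φ ⊆ halfPlane l c ∧ ∃ p ∈ frontier Φ, toPlane l ⬝ᵥ p = c

/-- Closed convex sets with at least one support half-plane of rational slope. -/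
structure IsAdmissible (Φ : Set Plane) : Prop where
  closed : IsClosed Φ
  convex : Convex ℝ Φ
  exists_support : ∃ l c, IsSupport Φ l c

/-- The tropical propagation `Φ(t)`: the intersection of all support half-planes of
rational slope, each moved inwards by `t`. -/
def propagation (Φ : Set Plane) (t : ℝ) : Set Plane :=
  {p | ∀ l c, IsSupport Φ l c → p ∈ halfPlane l (c + t)}

/-- The final time in `[0, ∞]`: the least `t ≥ 0` for which `Φ(t)` has empty interior, and `⊤` if
there is no such `t`. -/
noncomputable def finalTime (Φ : Set Plane) : EReal :=
  sInf ((fun t : ℝ => (t : EReal)) '' {t : ℝ | 0 ≤ t ∧ interior (propagation Φ t) = ∅})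

/-- The final locus `Φ(t_Φ)`; it is empty if the final time is infinite. -/
def finalLocus (Φ : Set Plane) : Set Plane :=
  {p | ∃ T : ℝ, finalTime Φ = (T : EReal) ∧ p ∈ propagation Φ T}

/-- `p` is a vertex of the polygon `Φ(t)`, where `0 < t < t_Φ`. -/
def IsFrontVertex (Φ : Set Plane) (t : ℝ) (p : Plane) : Prop :=
  0 < t ∧ (t : EReal) < finalTime Φ ∧ p ∈ (propagation Φ t).extremePoints ℝ

/-- The tropical caustic: all vertices of the polygons `Φ(t)`, `0 < t < t_Φ`, together with the
final locus. -/
def caustic (Φ : Set Plane) : Set Plane :=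
  {p | ∃ t, IsFrontVertex Φ t p} ∪ finalLocus Φ

/-- The dual of the cone that coincides with the convex set `Ψ` near its point `p`. -/
def dualConeAt (Ψ : Set Plane) (p : Plane) : Set Plane :=
  {m | ∀ x ∈ Ψ, 0 ≤ m ⬝ᵥ (x - p)}

/-- `C` is an `A_{d-1}`-cone: a rational strictly convex cone of determinant `d`, width `d` and
height `1`. (For primitive generators of determinant `d ≥ 1` the width divides `d`, so
it is `d` exactly if `d` divides the difference of the generators.) -/
def IsACone (d : ℕ) (C : Set Plane) : Prop :=
  1 ≤ d ∧ ∃ l m u : Fin 2 → ℤ, Primitive l ∧ Primitive m ∧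
    (l 0 * m 1 - l 1 * m 0).natAbs = d ∧ l - m = (d : ℤ) • u ∧
    C = {x | ∃ a b : ℝ, 0 ≤ a ∧ 0 ≤ b ∧ x = a • toPlane l + b • toPlane m}

/-- `w` is the weight of the point `p` of the caustic of `Φ`: a vertex of `Φ(t)` of type `A_n`,
`0 < t < t_Φ`, has weight `n + 1`, and the points of the final locus have weight `2`. -/
def HasCausticWeight (Φ : Set Plane) (p : Plane) (w : ℕ) : Prop :=
  (∃ t, IsFrontVertex Φ t p ∧ IsACone w (dualConeAt (propagation Φ t) p)) ∨
    (p ∈ finalLocus Φ ∧ w = 2)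

/-- `p` is a vertex of the graph `K`: it lies on `K`, and `K` is not a straight
line segment with `p` in its relative interior, in any neighbourhood of `p`. -/
def IsGraphVertex (K : Set Plane) (p : Plane) : Prop :=
  p ∈ K ∧ ¬ ∃ (v : Plane) (U : Set Plane), v ≠ 0 ∧ IsOpen U ∧ p ∈ U ∧
    K ∩ U = {x | ∃ s : ℝ, x = p + s • v} ∩ U

/-- `P` is a (finite) lattice polygon whose interior contains exactly one lattice point,
namely `o`. -/
def IsReflexivePolygon (P : Set Plane) (o : Fin 2 → ℤ) : Prop :=
  (∃ S : Finset (Fin 2 → ℤ), P = convexHull ℝ (toPlane '' (S : Set (Fin 2 → ℤ)))) ∧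
    {z : Fin 2 → ℤ | toPlane z ∈ interior P} = {o}

/-- The two sets are related by a tropical isomorphism. -/
def TropicallyIsomorphic (P Q : Set Plane) : Prop := ∃ f, IsTropicalIso f ∧ f '' P = Q

/-- The polygon dual to `P` with respect to the point `o`. -/
def dualPolygon (P : Set Plane) (o : Plane) : Set Plane := {m | ∀ x ∈ P, -1 ≤ m ⬝ᵥ (x - o)}

/-- The side of the dual polygon that corresponds to the vertex `v` of `P`. -/
def dualSide (P : Set Plane) (o v : Plane) : Set Plane :=
  {m ∈ dualPolygon P o | m ⬝ᵥ (v - o) = -1}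

/-- `F` is a segment of rational slope, and its length measured by the primitive lattice vector
in its direction is `r`. -/
def HasTropicalLength (F : Set Plane) (r : ℝ) : Prop :=
  0 ≤ r ∧ ∃ (a : Plane) (u : Fin 2 → ℤ), Primitive u ∧ F = segment ℝ a (a + r • toPlane u)

/-- The caustic of `Φ` near `p` and the caustic of `Ψ` near `q` are isomorphic as weighted
graphs: a tropical isomorphism sends `p` to `q`, and on a neighbourhood of `p` it matches the
caustics and their weights. -/
def CausticsLocallyIsomorphic (Φ : Set Plane) (p : Plane) (Ψ : Set Plane) (q : Plane) : Prop :=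
  ∃ (f : Plane → Plane) (U : Set Plane), IsTropicalIso f ∧ f p = q ∧ IsOpen U ∧ p ∈ U ∧
    f '' (caustic Φ ∩ U) = caustic Ψ ∩ f '' U ∧
    ∀ x ∈ caustic Φ ∩ U, ∀ w : ℕ, HasCausticWeight Φ x w ↔ HasCausticWeight Ψ (f x) w

end TropicalPlane

open TropicalPlane

/-!
The theorem is a statement about fronts that end in a homothetic shrinking. Suppose that the fronts
`Φ(T - τ)`, for `0 ≤ τ ≤ τ₀`, are the sets `p + τ K` for one compact convex set `K` around the
origin (`ShrinksTo`). Then the final locus is `p`, the caustic near `p` consists of the rays from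
`p` through the extreme points of `K`, and the weight on a ray is read off from the dual cone of `K`
at its extreme point. In particular the weighted caustic near `p` depends on `K` only
(`ShrinksTo.causticsLocallyIsomorphic`), and it is not straight at `p`, since the extreme points of
`K` do not lie on one line (`ShrinksTo.isGraphVertex`).

A reflexive polygon shrinks in this way, from time `0` on, and `K` is the polygon itself
(`IsReflexivePolygon.shrinksTo`): its dual is again a lattice polygon, so that all its sides have
lattice distance one from the interior lattice point, while a support line of any other slope is at
least as far from that point by integrality. The side of the dual polygon dual to a vertex has
lattice distance one from the origin as well, hence its lattice length is the determinant of its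
end points, and these generate the dual cone (`IsReflexivePolygon.exists_weight`).

If the final locus of `Φ` is a single point `p`, reached at time `T`, then `Φ` is bounded, and every
primitive integral form `λ` takes a value at most `λ(p) - T` on `Φ`. By Dirichlet's approximation
theorem no real form can have its minimum at `p`, so `p` is an interior point of `Φ`. Therefore the
support lines of all but finitely many slopes are far from `p`, and those which do not reach `p` at
time `T` stay behind by an amount proportional to the size of the slope (`exists_gap`). Near time
`T` the front is thus cut out by the finitely many support lines that do reach `p`. Their slopes
span a lattice polygon `Q`; the origin is in its interior because `p` is the whole final locus, and
no other lattice point is, because every such `λ` is at most `λ(p) - T` somewhere on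
`Φ` (`exists_shrinksTo_of_final`). Hence `Q` is reflexive, and `K` is its dual.

It remains to classify the reflexive polygons with the origin as interior lattice point. Such a
polygon contains one of three minimal ones (`IsReflexivePolygon.containsMinimalModel`). Applied to
the dual polygon, this shows that every reflexive polygon is contained in one of the three polygons
dual to the minimal ones. From these, cutting off vertices leads, up to integral changes of
coordinates, only to the sixteen listed polygons (`IsReflexivePolygon.exists_model`). Counting
boundary lattice points, pairs of them whose sum is one of them, and those whose negative is one of
them tells the sixteen apart (`model_injective`).
-/

namespace TropicalPlane

open Filter Topology

/-! ### Linear forms and convex sets in the plane -/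

/-- The determinant of the pair `(u, v)`, over any commutative ring. -/
def cross {R : Type*} [CommRing R] (u v : Fin 2 → R) : R := u 0 * v 1 - u 1 * v 0

@[simp] lemma toPlane_apply (z : Fin 2 → ℤ) (i : Fin 2) : toPlane z i = (z i : ℝ) := rfl

@[simp] lemma toPlane_zero : toPlane 0 = 0 := by ext i; simp [toPlane]

lemma toPlane_injective : Function.Injective toPlane := by
  intro a b h
  ext i
  have := congrFun h i
  simpa using this

@[simp] lemma toPlane_eq_zero {z : Fin 2 → ℤ} : toPlane z = 0 ↔ z = 0 :=
  ⟨fun h => toPlane_injective (by simpa using h), by rintro rfl; simp⟩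

lemma toPlane_add (a b : Fin 2 → ℤ) : toPlane (a + b) = toPlane a + toPlane b := by
  ext i; simp [toPlane]

lemma toPlane_neg (a : Fin 2 → ℤ) : toPlane (-a) = -toPlane a := by
  ext i; simp [toPlane]

lemma dot_eq {R : Type*} [CommRing R] (x y : Fin 2 → R) : x ⬝ᵥ y = x 0 * y 0 + x 1 * y 1 := by
  simp [dotProduct, Fin.sum_univ_two]

lemma toPlane_dot (a b : Fin 2 → ℤ) : toPlane a ⬝ᵥ toPlane b = ((a ⬝ᵥ b : ℤ) : ℝ) := by
  simp

lemma cross_toPlane (a b : Fin 2 → ℤ) : cross (toPlane a) (toPlane b) = ((cross a b : ℤ) : ℝ) := by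
  simp [cross]

lemma dot_self_pos {m : Plane} (h : m ≠ 0) : 0 < m ⬝ᵥ m := by
  rw [dot_eq]
  by_contra hc
  apply h
  ext i
  fin_cases i <;> simp <;> nlinarith [mul_self_nonneg (m 0), mul_self_nonneg (m 1)]

lemma continuous_dot (m : Plane) : Continuous fun x : Plane => m ⬝ᵥ x := by
  simp only [dot_eq]; fun_prop

lemma exists_dot_eq (f : Plane →ₗ[ℝ] ℝ) : ∃ m : Plane, ∀ x, f x = m ⬝ᵥ x := by
  refine ⟨fun i => f (Pi.single i 1), fun x => ?_⟩
  have hx : x = x 0 • Pi.single 0 1 + x 1 • Pi.single 1 1 := by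
    ext i; fin_cases i <;> simp
  conv_lhs => rw [hx]
  rw [map_add, map_smul, map_smul, dot_eq]
  simp [mul_comm]

lemma convex_dot_ge (m : Plane) (c : ℝ) : Convex ℝ {x : Plane | c ≤ m ⬝ᵥ x} := by
  intro x hx y hy a b ha hb hab
  simp only [mem_ofPred_eq, dotProduct_add, dotProduct_smul, smul_eq_mul] at *
  calc c = a * c + b * c := by rw [← add_mul, hab, one_mul]
    _ ≤ _ := by gcongr

lemma isClosed_dot_ge (m : Plane) (c : ℝ) : IsClosed {x : Plane | c ≤ m ⬝ᵥ x} :=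
  isClosed_le continuous_const (continuous_dot m)

/-- A half-plane that contains the generators contains their convex hull. -/
lemma dot_ge_of_mem_convexHull {S : Set Plane} {m : Plane} {c : ℝ} (h : ∀ s ∈ S, c ≤ m ⬝ᵥ s)
    {x : Plane} (hx : x ∈ convexHull ℝ S) : c ≤ m ⬝ᵥ x :=
  convexHull_min (t := {x : Plane | c ≤ m ⬝ᵥ x}) h (convex_dot_ge m c) hx

lemma eventually_add_smul_mem_interior {C : Set Plane} {z : Plane} (hz : z ∈ interior C)
    (d : Plane) : ∀ᶠ e : ℝ in 𝓝 0, z + e • d ∈ interior C := by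
  have hc : ContinuousAt (fun e : ℝ => z + e • d) 0 := by fun_prop
  apply hc.eventually
  simpa using isOpen_interior.mem_nhds hz

lemma exists_add_smul_mem {C : Set Plane} {z : Plane} (hz : z ∈ interior C) (d : Plane) :
    ∃ e : ℝ, 0 < e ∧ z + e • d ∈ C := by
  have h := (eventually_add_smul_mem_interior hz d).filter_mono (nhdsWithin_le_nhds (s := Ioi 0))
  obtain ⟨e, he, he'⟩ := (h.and self_mem_nhdsWithin).exists
  exact ⟨e, he', interior_subset he⟩

/-- A nonzero linear form does not attain its minimum at an interior point. -/
lemma exists_dot_lt_of_mem_interior {C : Set Plane} {z m : Plane} (hz : z ∈ interior C)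
    (hm : m ≠ 0) : ∃ x ∈ C, m ⬝ᵥ x < m ⬝ᵥ z := by
  obtain ⟨e, he, hx⟩ := exists_add_smul_mem hz (-m)
  refine ⟨_, hx, ?_⟩
  simp only [dotProduct_add, dotProduct_smul, dotProduct_neg, smul_eq_mul]
  nlinarith [mul_pos he (dot_self_pos hm)]

lemma smul_mem_interior {C : Set Plane} (hC : Convex ℝ C) (h0 : (0 : Plane) ∈ interior C)
    {y : Plane} (hy : y ∈ C) {s : ℝ} (hs : 0 ≤ s) (hs' : s < 1) : s • y ∈ interior C := by
  simpa using hC.combo_interior_self_mem_interior h0 hy (sub_pos.2 hs') hs (by ring)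

/-- A point that is not interior to a convex set is separated from it by a linear form; no
interior or closedness of the convex set is needed in finite dimension. -/
lemma exists_dot_nonneg {C : Set Plane} (hC : Convex ℝ C) (h0 : (0 : Plane) ∉ interior C) :
    ∃ m : Plane, m ≠ 0 ∧ ∀ x ∈ C, 0 ≤ m ⬝ᵥ x := by
  rcases C.eq_empty_or_nonempty with rfl | hne
  · exact ⟨fun _ => 1, fun h => by simpa using congrFun h 0, by simp⟩
  by_cases hi : (interior C).Nonempty
  · obtain ⟨f, hf⟩ := geometric_hahn_banach_open_point hC.interior isOpen_interior h0
    obtain ⟨m, hm⟩ := exists_dot_eq (-(f : Plane →ₗ[ℝ] ℝ))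
    have hm' : ∀ x, m ⬝ᵥ x = - f x := fun x => by rw [← hm]; simp
    refine ⟨m, ?_, ?_⟩
    · rintro rfl
      obtain ⟨a, ha⟩ := hi
      have h1 := hf a ha
      have h2 := hm' a
      simp at h1 h2
      linarith
    · intro x hx
      have hx' : x ∈ closure (interior C) := by
        rw [hC.closure_interior_eq_closure_of_nonempty_interior hi]
        exact subset_closure hx
      refine closure_minimal (t := {x : Plane | 0 ≤ m ⬝ᵥ x}) ?_ (isClosed_dot_ge m 0) hx'
      intro y hy
      have := hf y hy
      simp only [map_zero] at this
      rw [mem_ofPred_eq, hm']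
      linarith
  · rw [hC.interior_nonempty_iff_affineSpan_eq_top,
      AffineSubspace.affineSpan_eq_top_iff_vectorSpan_eq_top_of_nonempty ℝ _ _ hne] at hi
    obtain ⟨f, hf, hle⟩ := Submodule.exists_le_ker_of_lt_top _ (lt_top_iff_ne_top.2 hi)
    obtain ⟨m, hm⟩ := exists_dot_eq f
    have hm0 : m ≠ 0 := by
      rintro rfl
      exact hf (LinearMap.ext fun x => by simp [hm x])
    obtain ⟨p, hp⟩ := hne
    have hconst : ∀ x ∈ C, m ⬝ᵥ x = m ⬝ᵥ p := by
      intro x hx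
      have := hle (vsub_mem_vectorSpan ℝ hx hp)
      rw [LinearMap.mem_ker, hm, vsub_eq_sub, dotProduct_sub] at this
      linarith
    rcases le_total 0 (m ⬝ᵥ p) with h | h
    · exact ⟨m, hm0, fun x hx => by rw [hconst x hx]; exact h⟩
    · exact ⟨-m, neg_ne_zero.2 hm0, fun x hx => by rw [neg_dotProduct, hconst x hx]; linarith⟩

/-- Bounded sets contain finitely many lattice points. -/
lemma finite_lattice_of_isBounded {C : Set Plane} (hC : Bornology.IsBounded C) :
    {z : Fin 2 → ℤ | toPlane z ∈ C}.Finite := by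
  obtain ⟨r, hr⟩ := hC.exists_norm_le
  refine (Set.finite_Icc (fun _ : Fin 2 => -⌈r⌉) (fun _ => ⌈r⌉)).subset ?_
  intro z hz
  have h : ∀ i, |(z i : ℝ)| ≤ ⌈r⌉ := fun i =>
    ((norm_le_pi_norm (toPlane z) i).trans (hr _ hz)).trans (Int.le_ceil r)
  refine ⟨fun i => ?_, fun i => ?_⟩
  · exact_mod_cast (abs_le.1 (h i)).1
  · exact_mod_cast (abs_le.1 (h i)).2

/-! ### Reflexive polygons and their duals -/

/-- The nonzero lattice points of a set; for a polygon whose only interior lattice point is the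
origin these are the lattice points of its boundary. -/
def latticePoints (Q : Set Plane) : Set (Fin 2 → ℤ) := {z | z ≠ 0 ∧ toPlane z ∈ Q}

lemma mem_dualPolygon_zero {Q : Set Plane} {m : Plane} :
    m ∈ dualPolygon Q 0 ↔ ∀ x ∈ Q, -1 ≤ m ⬝ᵥ x := by
  simp [dualPolygon]

lemma dualPolygon_zero_eq_iInter (Q : Set Plane) :
    dualPolygon Q 0 = ⋂ x ∈ Q, {m : Plane | -1 ≤ x ⬝ᵥ m} := by
  ext m
  simp only [mem_dualPolygon_zero, mem_iInter, mem_ofPred_eq, dotProduct_comm m]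

lemma convex_dualPolygon_zero (Q : Set Plane) : Convex ℝ (dualPolygon Q 0) := by
  rw [dualPolygon_zero_eq_iInter]
  exact convex_iInter₂ fun x _ => convex_dot_ge x (-1)

lemma isClosed_dualPolygon_zero (Q : Set Plane) : IsClosed (dualPolygon Q 0) := by
  rw [dualPolygon_zero_eq_iInter]
  exact isClosed_biInter fun x _ => isClosed_dot_ge x (-1)

section Reflexive

variable {Q : Set Plane} (h : IsReflexivePolygon Q 0)
include h

lemma IsReflexivePolygon.convex : Convex ℝ Q := by
  obtain ⟨⟨S, rfl⟩, -⟩ := h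
  exact convex_convexHull ℝ _

lemma IsReflexivePolygon.isCompact : IsCompact Q := by
  obtain ⟨⟨S, rfl⟩, -⟩ := h
  exact (S.finite_toSet.image _).isCompact_convexHull ℝ

lemma IsReflexivePolygon.zero_mem_interior : (0 : Plane) ∈ interior Q := by
  have : (0 : Fin 2 → ℤ) ∈ {z : Fin 2 → ℤ | toPlane z ∈ interior Q} := by rw [h.2]; rfl
  simpa using this

lemma IsReflexivePolygon.eq_zero {z : Fin 2 → ℤ} (hz : toPlane z ∈ interior Q) : z = 0 := by
  have : z ∈ {z : Fin 2 → ℤ | toPlane z ∈ interior Q} := hz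
  rwa [h.2] at this

lemma IsReflexivePolygon.finite_latticePoints : (latticePoints Q).Finite :=
  (finite_lattice_of_isBounded h.isCompact.isBounded).subset fun _ hz => hz.2

/-- The lattice points of a reflexive polygon surround the origin: no nonzero linear form is
nonnegative on all of them. -/
lemma IsReflexivePolygon.exists_dot_neg {m : Plane} (hm : m ≠ 0) :
    ∃ l ∈ latticePoints Q, m ⬝ᵥ toPlane l < 0 := by
  by_contra hc
  push Not at hc
  obtain ⟨x, hx, hlt⟩ := exists_dot_lt_of_mem_interior h.zero_mem_interior hm
  obtain ⟨S, hS⟩ := h.1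
  rw [hS] at hx
  rw [dotProduct_zero] at hlt
  refine absurd (dot_ge_of_mem_convexHull (c := 0) ?_ hx) (not_le.2 hlt)
  rintro _ ⟨s, hs, rfl⟩
  by_cases h0 : s = 0
  · simp [h0]
  · exact hc s ⟨h0, by rw [hS]; exact subset_convexHull ℝ _ ⟨s, hs, rfl⟩⟩

lemma IsReflexivePolygon.eq_convexHull :
    Q = convexHull ℝ (toPlane '' latticePoints Q) := by
  apply subset_antisymm
  · obtain ⟨S, hS⟩ := h.1
    conv_lhs => rw [hS]
    refine convexHull_min ?_ (convex_convexHull ℝ _)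
    rintro _ ⟨s, hs, rfl⟩
    by_cases h0 : s = 0
    · rw [h0, toPlane_zero]
      by_contra hc
      obtain ⟨m, hm, hm'⟩ := exists_dot_nonneg (convex_convexHull ℝ (toPlane '' latticePoints Q))
        (fun hi => hc (interior_subset hi))
      obtain ⟨l, hl, hlt⟩ := h.exists_dot_neg hm
      exact absurd (hm' _ (subset_convexHull ℝ _ ⟨l, hl, rfl⟩)) (not_le.2 hlt)
    · exact subset_convexHull ℝ _
        ⟨s, ⟨h0, by rw [hS]; exact subset_convexHull ℝ _ ⟨s, hs, rfl⟩⟩, rfl⟩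
  · refine convexHull_min ?_ h.convex
    rintro _ ⟨s, hs, rfl⟩
    exact hs.2

lemma IsReflexivePolygon.mem_dual_iff {m : Plane} :
    m ∈ dualPolygon Q 0 ↔ ∀ l ∈ latticePoints Q, -1 ≤ m ⬝ᵥ toPlane l := by
  rw [mem_dualPolygon_zero]
  constructor
  · exact fun hm l hl => hm _ hl.2
  · intro hm x hx
    rw [h.eq_convexHull] at hx
    refine dot_ge_of_mem_convexHull ?_ hx
    rintro _ ⟨l, hl, rfl⟩
    exact hm l hl

/-- A boundary lattice point shrunk towards the origin is no lattice point. -/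
lemma IsReflexivePolygon.not_smul {x : Plane} (hx : x ∈ Q) {s : ℝ} (hs : 0 ≤ s) (hs' : s < 1)
    {z : Fin 2 → ℤ} (hz : z ≠ 0) : toPlane z ≠ s • x := by
  intro he
  exact hz (h.eq_zero (he ▸ smul_mem_interior h.convex h.zero_mem_interior hx hs hs'))

/-- If the determinant of two boundary lattice points is at least two, then a further lattice
point lies between them on a side of the polygon. -/
lemma IsReflexivePolygon.exists_between {u v : Fin 2 → ℤ} (hu : u ∈ latticePoints Q)
    (hv : v ∈ latticePoints Q) (huv : 2 ≤ cross u v) :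
    ∃ y ∈ latticePoints Q, 0 < cross u y ∧ 0 < cross y v ∧
      cross u y + cross y v = cross u v := by
  set D := cross u v with hD
  have hD0 : 0 < D := by omega
  -- Some unit vector is not an integral combination of `u` and `v`.
  obtain ⟨e, he⟩ : ∃ e : Fin 2 → ℤ, ¬ (D ∣ cross e v ∧ D ∣ cross u e) := by
    by_contra hc
    push Not at hc
    have h1 := hc ![1, 0]
    have h2 := hc ![0, 1]
    simp only [cross, Fin.isValue, cons_val_zero, cons_val_one, one_mul, zero_mul, mul_zero,
      mul_one, sub_zero, zero_sub, dvd_neg] at h1 h2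
    have h3 : D * D ∣ D := by
      conv_rhs => rw [hD, cross]
      refine dvd_sub (mul_dvd_mul h2.2 h1.1) ?_
      exact mul_dvd_mul h1.2 h2.1
    have := Int.le_of_dvd hD0 h3
    nlinarith
  -- Its fractional part is a nonzero lattice point `z` of the half-open parallelogram.
  set z : Fin 2 → ℤ := e - (cross e v / D) • u - (cross u e / D) • v with hz
  have hz1 : cross z v = cross e v % D := by
    have : ∀ a b : ℤ, cross (e - a • u - b • v) v = cross e v - cross u v * a := by
      intro a b; simp only [cross, Pi.sub_apply, Pi.smul_apply, smul_eq_mul]; ring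
    rw [hz, this, Int.emod_def]
  have hz2 : cross u z = cross u e % D := by
    have : ∀ a b : ℤ, cross u (e - a • u - b • v) = cross u e - cross u v * b := by
      intro a b; simp only [cross, Pi.sub_apply, Pi.smul_apply, smul_eq_mul]; ring
    rw [hz, this, Int.emod_def]
  have ha := Int.emod_nonneg (cross e v) hD0.ne'
  have hb := Int.emod_nonneg (cross u e) hD0.ne'
  have ha' := Int.emod_lt_of_pos (cross e v) hD0
  have hb' := Int.emod_lt_of_pos (cross u e) hD0
  have hne : ¬ (cross e v % D = 0 ∧ cross u e % D = 0) := fun hc =>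
    he ⟨Int.dvd_of_emod_eq_zero hc.1, Int.dvd_of_emod_eq_zero hc.2⟩
  -- After a reflection `z` may be assumed to lie in the triangle with vertices `0`, `u`, `v`.
  obtain ⟨y, hy1, hy2, hy3, hy1', hy2', hy0⟩ : ∃ y : Fin 2 → ℤ, 0 ≤ cross y v ∧ 0 ≤ cross u y ∧
      cross u y + cross y v ≤ D ∧ cross y v < D ∧ cross u y < D ∧
      0 < cross u y + cross y v := by
    by_cases hle : cross u e % D + cross e v % D ≤ D
    · exact ⟨z, by omega, by omega, by omega, by omega, by omega, by omega⟩
    · have h1 : cross (u + v - z) v = D - cross z v := by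
        rw [hD]; simp only [cross, Pi.sub_apply, Pi.add_apply]; ring
      have h2 : cross u (u + v - z) = D - cross u z := by
        rw [hD]; simp only [cross, Pi.sub_apply, Pi.add_apply]; ring
      exact ⟨u + v - z, by omega, by omega, by omega, by omega, by omega, by omega⟩
  have hDR : (0 : ℝ) < D := by exact_mod_cast hD0
  set s : ℝ := ((cross u y + cross y v : ℤ) : ℝ) / D with hs
  have hs0 : 0 < s := div_pos (by exact_mod_cast hy0) hDR
  have hs1 : s ≤ 1 := (div_le_one hDR).2 (by exact_mod_cast hy3)
  have hyne : y ≠ 0 := by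
    rintro rfl
    simp [cross] at hy0
  have hw0 : (0 : ℝ) < ((cross u y + cross y v : ℤ) : ℝ) := by exact_mod_cast hy0
  -- `q` is the point of the segment from `u` to `v` on the ray through `y`.
  set q : Plane := (((cross y v : ℤ) : ℝ) / ((cross u y + cross y v : ℤ) : ℝ)) • toPlane u +
    (((cross u y : ℤ) : ℝ) / ((cross u y + cross y v : ℤ) : ℝ)) • toPlane v with hq
  have hqQ : q ∈ Q := by
    refine h.convex hu.2 hv.2 (div_nonneg (by exact_mod_cast hy1) hw0.le)
      (div_nonneg (by exact_mod_cast hy2) hw0.le) ?_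
    rw [← add_div, div_eq_one_iff_eq hw0.ne']
    push_cast; ring
  have hyq : toPlane y = s • q := by
    have key : ∀ i, (D : ℝ) * y i = cross y v * u i + cross u y * v i := by
      intro i
      have : D * y i = cross y v * u i + cross u y * v i := by
        rw [hD]; fin_cases i <;> simp [cross] <;> ring
      exact_mod_cast this
    ext i
    have hk := key i
    simp only [hs, hq, Pi.smul_apply, Pi.add_apply, smul_eq_mul, toPlane_apply]
    field_simp
    linarith
  have hs1' : s = 1 := by
    by_contra hne'
    exact h.not_smul hqQ hs0.le (lt_of_le_of_ne hs1 hne') hyne hyq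
  have hsum : cross u y + cross y v = D := by
    have := (div_eq_one_iff_eq hDR.ne').1 hs1'
    exact_mod_cast this
  refine ⟨y, ⟨hyne, ?_⟩, by omega, by omega, hsum⟩
  rw [hyq, hs1', one_smul]
  exact hqQ

/-- Parallel boundary lattice points are equal or opposite. -/
lemma IsReflexivePolygon.eq_or_eq_neg {u v : Fin 2 → ℤ} (hu : u ∈ latticePoints Q)
    (hv : v ∈ latticePoints Q) (huv : cross u v = 0) : v = u ∨ v = -u := by
  -- `v` is a real multiple of `u`; a factor of absolute value other than one would give an
  -- interior lattice point.
  have hpos : 0 < toPlane u ⬝ᵥ toPlane u := dot_self_pos (by simpa using hu.1)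
  obtain ⟨c, hc⟩ : ∃ c : ℝ, toPlane v = c • toPlane u := by
    refine ⟨(toPlane u ⬝ᵥ toPlane v) / (toPlane u ⬝ᵥ toPlane u), ?_⟩
    have h1 : (u 0 : ℝ) * v 1 - u 1 * v 0 = 0 := by exact_mod_cast huv
    have key : (toPlane u ⬝ᵥ toPlane u) • toPlane v = (toPlane u ⬝ᵥ toPlane v) • toPlane u := by
      ext i
      fin_cases i
      · simp; linear_combination (-(u 1 : ℝ)) * h1
      · simp; linear_combination (u 0 : ℝ) * h1
    rw [div_eq_inv_mul, mul_smul, ← key, smul_smul, inv_mul_cancel₀ hpos.ne', one_smul]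
  have hc0 : c ≠ 0 := by
    rintro rfl
    exact hv.1 (by simpa using hc)
  have hv' : toPlane u = c⁻¹ • toPlane v := by rw [hc, smul_smul, inv_mul_cancel₀ hc0, one_smul]
  rcases lt_or_gt_of_ne hc0 with hneg | hpos
  · right
    have h1 : ¬ -c < 1 := fun hlt =>
      h.not_smul hu.2 (by linarith) hlt (neg_ne_zero.2 hv.1) (by rw [toPlane_neg, hc, neg_smul])
    have h2 : ¬ -c⁻¹ < 1 := fun hlt =>
      h.not_smul hv.2 (by have := inv_lt_zero.2 hneg; linarith) hlt (neg_ne_zero.2 hu.1)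
        (by rw [toPlane_neg, neg_smul, ← hv'])
    have h3 : c = -1 := by
      have h4 : c * c⁻¹ = 1 := mul_inv_cancel₀ hc0
      nlinarith
    apply toPlane_injective
    rw [hc, h3, toPlane_neg, neg_smul, one_smul]
  · left
    have h1 : ¬ c < 1 := fun hlt => h.not_smul hu.2 hpos.le hlt hv.1 hc
    have h2 : ¬ c⁻¹ < 1 := fun hlt => h.not_smul hv.2 (inv_pos.2 hpos).le hlt hu.1 hv'
    have h3 : c = 1 := by
      have h4 : c * c⁻¹ = 1 := mul_inv_cancel₀ hc0
      nlinarith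
    apply toPlane_injective
    rw [hc, h3, one_smul]

/-- Every vertex of the dual polygon lies on the sides dual to two boundary lattice points of
determinant one. -/
lemma IsReflexivePolygon.exists_active_pair {x : Plane}
    (hx : x ∈ (dualPolygon Q 0).extremePoints ℝ) :
    ∃ l ∈ latticePoints Q, ∃ m ∈ latticePoints Q, cross l m = 1 ∧
      x ⬝ᵥ toPlane l = -1 ∧ x ⬝ᵥ toPlane m = -1 := by
  have hxd := h.mem_dual_iff.1 hx.1
  -- Two independent constraints are active at `x`: otherwise `x` could be moved both ways.
  have move : ∀ d : Plane, d ≠ 0 →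
      ∃ l ∈ latticePoints Q, x ⬝ᵥ toPlane l = -1 ∧ d ⬝ᵥ toPlane l ≠ 0 := by
    intro d hd
    by_contra hc
    push Not at hc
    have hev : ∀ l ∈ latticePoints Q, ∀ᶠ e : ℝ in 𝓝 0,
        -1 ≤ (x + e • d) ⬝ᵥ toPlane l ∧ -1 ≤ (x - e • d) ⬝ᵥ toPlane l := by
      intro l hl
      simp only [add_dotProduct, sub_dotProduct, smul_dotProduct, smul_eq_mul]
      rcases (hxd l hl).lt_or_eq with hlt | heq
      · have c1 : ContinuousAt (fun e : ℝ => x ⬝ᵥ toPlane l + e * d ⬝ᵥ toPlane l) 0 := by fun_prop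
        have c2 : ContinuousAt (fun e : ℝ => x ⬝ᵥ toPlane l - e * d ⬝ᵥ toPlane l) 0 := by fun_prop
        filter_upwards [c1.eventually (lt_mem_nhds (a := -1) (by simpa using hlt)),
          c2.eventually (lt_mem_nhds (a := -1) (by simpa using hlt))] with e h1 h2
        exact ⟨h1.le, h2.le⟩
      · rw [hc l hl heq.symm, ← heq]
        simp
    have hall := (h.finite_latticePoints.eventually_all).2 hev
    have hpos := hall.filter_mono (nhdsWithin_le_nhds (s := Ioi 0))
    obtain ⟨e, he, he0⟩ := (hpos.and self_mem_nhdsWithin).exists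
    have hm1 : x + e • d ∈ dualPolygon Q 0 := h.mem_dual_iff.2 fun l hl => (he l hl).1
    have hm2 : x - e • d ∈ dualPolygon Q 0 := h.mem_dual_iff.2 fun l hl => (he l hl).2
    have hmid : x ∈ openSegment ℝ (x + e • d) (x - e • d) :=
      ⟨1 / 2, 1 / 2, by norm_num, by norm_num, by norm_num, by module⟩
    have := hx.2 hm1 hm2 hmid
    have h0 : e • d = 0 := by simpa using this
    rcases smul_eq_zero.1 h0 with h1 | h1
    · exact (ne_of_gt (mem_Ioi.1 he0)) h1
    · exact hd h1
  obtain ⟨l, hl, hlx, -⟩ := move (fun _ => 1) (fun h0 => by simpa using congrFun h0 0)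
  obtain ⟨m, hm, hmx, hlm⟩ := move ![-(l 1 : ℝ), l 0] (by
    intro h0
    apply hl.1
    have h1 := congrFun h0 0
    have h2 := congrFun h0 1
    simp at h1 h2
    ext i; fin_cases i <;> simp [h1, h2])
  have hcr : cross l m ≠ 0 := by
    intro hc
    apply hlm
    have : (l 0 : ℝ) * m 1 - l 1 * m 0 = 0 := by exact_mod_cast hc
    rw [dot_eq]
    simp
    linarith
  -- Lattice points on the side between `l` and `m` are active too, and they lower the determinant.
  have descend : ∀ n : ℕ, ∀ l ∈ latticePoints Q, ∀ m ∈ latticePoints Q, cross l m = n → 0 < n →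
      x ⬝ᵥ toPlane l = -1 → x ⬝ᵥ toPlane m = -1 →
      ∃ l ∈ latticePoints Q, ∃ m ∈ latticePoints Q, cross l m = 1 ∧
      x ⬝ᵥ toPlane l = -1 ∧ x ⬝ᵥ toPlane m = -1 := by
    intro n
    induction n using Nat.strong_induction_on with
    | _ n ih =>
      intro l hl m hm hn hn0 hlx hmx
      by_cases h1 : n = 1
      · exact ⟨l, hl, m, hm, by rw [hn, h1]; rfl, hlx, hmx⟩
      obtain ⟨y, hy, hy1, hy2, hy3⟩ := h.exists_between hl hm (by omega)
      refine ih (cross l y).toNat (by omega) l hl y hy (by omega) (by omega) hlx ?_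
      have key : ∀ i, ((cross l m : ℤ) : ℝ) * y i = cross y m * l i + cross l y * m i := by
        intro i
        have : cross l m * y i = cross y m * l i + cross l y * m i := by
          fin_cases i <;> simp [cross] <;> ring
        exact_mod_cast this
      have hne : ((cross l m : ℤ) : ℝ) ≠ 0 := by
        rw [hn]; exact_mod_cast hn0.ne'
      have hs : ((cross l y : ℤ) : ℝ) + cross y m = cross l m := by exact_mod_cast hy3
      apply mul_left_cancel₀ hne
      rw [dot_eq] at *
      simp only [toPlane_apply] at *
      linear_combination x 0 * key 0 + x 1 * key 1 + ((cross y m : ℤ) : ℝ) * hlx +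
        ((cross l y : ℤ) : ℝ) * hmx - hs
  rcases lt_or_gt_of_ne hcr with hneg | hpos
  · have hs : cross m l = -cross l m := by simp only [cross]; ring
    exact descend (cross m l).toNat m hm l hl (by omega) (by omega) hmx hlx
  · exact descend (cross l m).toNat l hl m hm (by omega) (by omega) hlx hmx

lemma IsReflexivePolygon.exists_lattice_of_extreme {x : Plane}
    (hx : x ∈ (dualPolygon Q 0).extremePoints ℝ) : ∃ z, x = toPlane z := by
  obtain ⟨l, -, m, -, hlm, h1, h2⟩ := h.exists_active_pair hx
  have hd : (l 0 : ℝ) * m 1 - l 1 * m 0 = 1 := by exact_mod_cast hlm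
  rw [dot_eq] at h1 h2
  simp only [toPlane_apply] at h1 h2
  refine ⟨![l 1 - m 1, m 0 - l 0], ?_⟩
  ext i
  fin_cases i
  · simp
    linear_combination (m 1 : ℝ) * h1 - (l 1 : ℝ) * h2 - x 0 * hd
  · simp
    linear_combination -(m 0 : ℝ) * h1 + (l 0 : ℝ) * h2 - x 1 * hd

lemma IsReflexivePolygon.isCompact_dual : IsCompact (dualPolygon Q 0) := by
  refine Metric.isCompact_of_isClosed_isBounded (isClosed_dualPolygon_zero Q) ?_
  -- `Q` contains a small multiple of every signed unit vector.
  have hb : ∀ d : Plane, ∃ C : ℝ, ∀ m ∈ dualPolygon Q 0, -C ≤ m ⬝ᵥ d := by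
    intro d
    obtain ⟨e, he, hx⟩ := exists_add_smul_mem h.zero_mem_interior d
    refine ⟨1 / e, fun m hm => ?_⟩
    have := mem_dualPolygon_zero.1 hm _ hx
    rw [zero_add, dotProduct_smul, smul_eq_mul] at this
    rw [neg_le, ← mul_le_mul_iff_right₀ he]
    field_simp
    linarith
  obtain ⟨C1, h1⟩ := hb ![1, 0]
  obtain ⟨C2, h2⟩ := hb ![-1, 0]
  obtain ⟨C3, h3⟩ := hb ![0, 1]
  obtain ⟨C4, h4⟩ := hb ![0, -1]
  refine (Metric.isBounded_Icc (![-C1, -C3] : Plane) ![C2, C4]).subset fun m hm => ?_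
  have h1 := h1 m hm
  have h2 := h2 m hm
  have h3 := h3 m hm
  have h4 := h4 m hm
  simp only [dot_eq, cons_val_zero, cons_val_one, mul_one, mul_zero, add_zero, zero_add,
    mul_neg] at h1 h2 h3 h4
  refine ⟨fun i => ?_, fun i => ?_⟩ <;> fin_cases i <;> simp <;> linarith

/-- The dual of a reflexive polygon is a reflexive polygon. -/
lemma IsReflexivePolygon.dual : IsReflexivePolygon (dualPolygon Q 0) 0 := by
  constructor
  · have hfin := finite_lattice_of_isBounded h.isCompact_dual.isBounded
    refine ⟨hfin.toFinset, ?_⟩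
    rw [hfin.coe_toFinset]
    apply subset_antisymm
    · have hsub : (dualPolygon Q 0).extremePoints ℝ ⊆
          toPlane '' {z | toPlane z ∈ dualPolygon Q 0} := by
        intro x hx
        obtain ⟨z, rfl⟩ := h.exists_lattice_of_extreme hx
        exact ⟨z, hx.1, rfl⟩
      have := closure_minimal (convexHull_mono hsub) ((hfin.image _).isClosed_convexHull ℝ)
      rwa [closure_convexHull_extremePoints h.isCompact_dual (convex_dualPolygon_zero Q)] at this
    · refine convexHull_min ?_ (convex_dualPolygon_zero Q)
      rintro _ ⟨z, hz, rfl⟩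
      exact hz
  · ext z
    simp only [mem_ofPred_eq, mem_singleton_iff]
    constructor
    · intro hz
      -- At an interior lattice point all the integers `z · l` exceed `-1`.
      by_contra h0
      have hz0 : toPlane z ≠ 0 := by simpa using h0
      obtain ⟨l, hl, hlt⟩ := h.exists_dot_neg hz0
      obtain ⟨y, hy, hylt⟩ := exists_dot_lt_of_mem_interior hz
        (m := toPlane l) (by simpa using hl.1)
      have h1 := mem_dualPolygon_zero.1 hy _ hl.2
      rw [dotProduct_comm] at h1
      have h2 : (-1 : ℝ) < toPlane z ⬝ᵥ toPlane l := by
        rw [dotProduct_comm (toPlane z)]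
        linarith
      rw [toPlane_dot] at h2 hlt
      have h3 : -1 < z ⬝ᵥ l := by exact_mod_cast h2
      have h4 : z ⬝ᵥ l < 0 := by exact_mod_cast hlt
      omega
    · rintro rfl
      rw [toPlane_zero, mem_interior_iff_mem_nhds]
      have hev : ∀ l ∈ latticePoints Q, ∀ᶠ m : Plane in 𝓝 0, -1 ≤ m ⬝ᵥ toPlane l := by
        intro l _
        have hc := (continuous_dot (toPlane l)).continuousAt (x := 0)
        filter_upwards [hc.eventually (lt_mem_nhds (a := -1) (by simp))] with m hm
        rw [dotProduct_comm]
        exact le_of_lt hm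
      filter_upwards [(h.finite_latticePoints.eventually_all).2 hev] with m hm
      exact h.mem_dual_iff.2 hm

end Reflexive

/-- The bipolar theorem for closed convex sets that contain the origin. -/
lemma dualPolygon_dualPolygon {C : Set Plane} (hC : Convex ℝ C) (hcl : IsClosed C)
    (h0 : (0 : Plane) ∈ C) : dualPolygon (dualPolygon C 0) 0 = C := by
  apply subset_antisymm
  · intro x hx
    by_contra hxC
    obtain ⟨f, c, hlt, hgt⟩ := geometric_hahn_banach_point_closed hC hcl hxC
    obtain ⟨m, hm⟩ := exists_dot_eq (f : Plane →ₗ[ℝ] ℝ)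
    have hm' : ∀ y, f y = m ⬝ᵥ y := hm
    have hc : c < 0 := by simpa using hgt 0 h0
    have hmem : (-c)⁻¹ • m ∈ dualPolygon C 0 := by
      rw [mem_dualPolygon_zero]
      intro y hy
      have := hgt y hy
      rw [hm'] at this
      rw [smul_dotProduct, smul_eq_mul, ← mul_le_mul_iff_right₀ (neg_pos.2 hc), ← mul_assoc,
        mul_inv_cancel₀ (neg_pos.2 hc).ne']
      linarith
    have := mem_dualPolygon_zero.1 hx _ hmem
    rw [dotProduct_comm, smul_dotProduct, smul_eq_mul, ← hm',
      ← mul_le_mul_iff_right₀ (neg_pos.2 hc), ← mul_assoc,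
      mul_inv_cancel₀ (neg_pos.2 hc).ne'] at this
    linarith
  · intro x hx
    rw [mem_dualPolygon_zero]
    intro m hm
    rw [dotProduct_comm]
    exact mem_dualPolygon_zero.1 hm x hx

lemma IsReflexivePolygon.dual_dual {K : Set Plane} (h : IsReflexivePolygon K 0) :
    dualPolygon (dualPolygon K 0) 0 = K :=
  dualPolygon_dualPolygon h.convex h.isCompact.isClosed (interior_subset h.zero_mem_interior)

/-! ### Minimal reflexive polygons -/

/-- Cramer's rule. -/
lemma cross_smul_eq {R : Type*} [CommRing R] (u v w : Fin 2 → R) :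
    cross u v • w = cross w v • u + cross u w • v := by
  ext i
  fin_cases i <;> simp [cross] <;> ring

/-- The set contains the vertices of one of the three minimal reflexive polygons, in suitable
integral coordinates: those of the triangle with vertices `u`, `v`, `-(u + v)`, of the
parallelogram with vertices `±u`, `±v`, or of the triangle with vertices `u`, `2 y - u`, `-y`,
together with its lattice point `y`. -/
def ContainsMinimalModel (A : Set (Fin 2 → ℤ)) : Prop :=
  (∃ u ∈ A, ∃ v ∈ A, cross u v = 1 ∧ -(u + v) ∈ A) ∨
    (∃ u ∈ A, ∃ v ∈ A, cross u v = 1 ∧ -u ∈ A ∧ -v ∈ A) ∨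
    ∃ u ∈ A, ∃ y ∈ A, cross u y = 1 ∧ -y ∈ A ∧ 2 • y - u ∈ A

section MinimalModels

variable {Q : Set Plane} (h : IsReflexivePolygon Q 0)
include h

lemma IsReflexivePolygon.exists_cross_pos {u : Fin 2 → ℤ} (hu : u ≠ 0) :
    ∃ v ∈ latticePoints Q, 0 < cross u v := by
  obtain ⟨v, hv, hlt⟩ := h.exists_dot_neg (m := toPlane ![u 1, -u 0]) (by
    rw [Ne, toPlane_eq_zero]
    intro h0
    have h1 := congrFun h0 0
    have h2 := congrFun h0 1
    simp at h1 h2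
    apply hu
    ext i; fin_cases i <;> simp [h1, h2])
  refine ⟨v, hv, ?_⟩
  rw [toPlane_dot] at hlt
  have h3 : ![u 1, -u 0] ⬝ᵥ v < 0 := by exact_mod_cast hlt
  rw [dot_eq] at h3
  simp only [cons_val_zero, cons_val_one] at h3
  rw [cross]
  linarith

lemma IsReflexivePolygon.exists_cross_neg {u : Fin 2 → ℤ} (hu : u ≠ 0) :
    ∃ v ∈ latticePoints Q, cross u v < 0 := by
  obtain ⟨v, hv, hp⟩ := h.exists_cross_pos (neg_ne_zero.2 hu)
  refine ⟨v, hv, ?_⟩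
  simp only [cross, Pi.neg_apply] at *
  linarith

lemma IsReflexivePolygon.exists_cross_left_eq_one {y : Fin 2 → ℤ} (hy : y ∈ latticePoints Q) :
    ∃ u ∈ latticePoints Q, cross u y = 1 := by
  have descend : ∀ n : ℕ, ∀ u ∈ latticePoints Q, cross u y = n → 0 < n →
      ∃ u ∈ latticePoints Q, cross u y = 1 := by
    intro n
    induction n using Nat.strong_induction_on with
    | _ n ih =>
      intro u hu hn hn0
      by_cases h1 : n = 1
      · exact ⟨u, hu, by rw [hn, h1]; rfl⟩
      obtain ⟨z, hz, hz1, hz2, hz3⟩ := h.exists_between hu hy (by omega)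
      exact ih (cross z y).toNat (by omega) z hz (by omega) (by omega)
  obtain ⟨u, hu, hlt⟩ := h.exists_cross_neg hy.1
  have hs : cross u y = -cross y u := by simp only [cross]; ring
  exact descend (cross u y).toNat u hu (by omega) (by omega)

lemma IsReflexivePolygon.exists_cross_right_eq_one {y : Fin 2 → ℤ} (hy : y ∈ latticePoints Q) :
    ∃ v ∈ latticePoints Q, cross y v = 1 := by
  have descend : ∀ n : ℕ, ∀ u ∈ latticePoints Q, cross y u = n → 0 < n →
      ∃ u ∈ latticePoints Q, cross y u = 1 := by
    intro n
    induction n using Nat.strong_induction_on with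
    | _ n ih =>
      intro u hu hn hn0
      by_cases h1 : n = 1
      · exact ⟨u, hu, by rw [hn, h1]; rfl⟩
      obtain ⟨z, hz, hz1, hz2, hz3⟩ := h.exists_between hy hu (by omega)
      exact ih (cross y z).toNat (by omega) z hz (by omega) (by omega)
  obtain ⟨u, hu, hlt⟩ := h.exists_cross_pos hy.1
  exact descend (cross y u).toNat u hu (by omega) (by omega)

/-- If two opposite lattice points `±y` lie on the boundary, then lattice points `u` and `v` at
distance one on both sides of their line satisfy `u + v = k y`, and convexity gives `|k| ≤ 2`. -/
lemma IsReflexivePolygon.containsMinimalModel_of_neg_mem {y : Fin 2 → ℤ}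
    (hy : y ∈ latticePoints Q) (hy' : -y ∈ latticePoints Q) :
    ContainsMinimalModel (latticePoints Q) := by
  obtain ⟨u, hu, huy⟩ := h.exists_cross_left_eq_one hy
  obtain ⟨v, hv, hyv⟩ := h.exists_cross_right_eq_one hy
  have key : cross u v • y = u + v := by
    rw [cross_smul_eq, huy, hyv, one_smul, one_smul]
  set k := cross u v with hk
  have hmid : (1 / 2 : ℝ) • toPlane u + (1 / 2 : ℝ) • toPlane v = ((k : ℝ) / 2) • toPlane y := by
    ext i
    have := congrFun key i
    simp only [Pi.smul_apply, Pi.add_apply, smul_eq_mul] at this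
    have h2 : (k : ℝ) * y i = u i + v i := by exact_mod_cast this
    simp only [Pi.smul_apply, Pi.add_apply, smul_eq_mul, toPlane_apply]
    linarith
  have hmem : ((k : ℝ) / 2) • toPlane y ∈ Q :=
    hmid ▸ h.convex hu.2 hv.2 (by norm_num) (by norm_num) (by norm_num)
  have hk2 : k ≤ 2 := by
    by_contra hc
    have h3 : (3 : ℝ) ≤ k := by exact_mod_cast (by omega : 3 ≤ k)
    refine h.not_smul hmem (s := 2 / k) (by positivity)
      ((div_lt_one (by linarith)).2 (by linarith)) hy.1 ?_
    rw [smul_smul, div_mul_div_cancel₀ (by linarith), div_self two_ne_zero, one_smul]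
  have hk2' : -2 ≤ k := by
    by_contra hc
    have h3 : (k : ℝ) ≤ -3 := by exact_mod_cast (by omega : k ≤ -3)
    refine h.not_smul hmem (s := 2 / (-k)) (div_nonneg zero_le_two (by linarith))
      ((div_lt_one (by linarith)).2 (by linarith)) hy'.1 ?_
    rw [smul_smul, toPlane_neg]
    have : (2 : ℝ) / (-k) * (k / 2) = -1 := by
      have : (k : ℝ) ≠ 0 := by linarith
      field_simp
    rw [this, neg_smul, one_smul]
  have hvu : cross v u = -k := by rw [hk]; simp only [cross]; ring
  have hcase : k = -2 ∨ k = -1 ∨ k = 0 ∨ k = 1 ∨ k = 2 := by omega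
  rcases hcase with h2 | h2 | h2 | h2 | h2 <;> rw [h2] at key
  · right; right
    refine ⟨v, hv, -y, hy', ?_, by simpa using hy, ?_⟩
    · rw [← hyv]; simp only [cross, Pi.neg_apply]; ring
    · convert hu using 1
      rw [eq_sub_of_add_eq key.symm]
      module
  · left
    refine ⟨v, hv, u, hu, by rw [hvu, h2]; rfl, ?_⟩
    convert hy using 1
    rw [add_comm, ← key]; module
  · right; left
    have hv' : v = -u := by
      rw [zero_smul] at key
      exact (neg_eq_of_add_eq_zero_right key.symm).symm
    exact ⟨u, hu, y, hy, huy, hv' ▸ hv, hy'⟩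
  · left
    refine ⟨u, hu, v, hv, by rw [← hk, h2], ?_⟩
    convert hy' using 1
    rw [← key]; module
  · right; right
    refine ⟨u, hu, y, hy, huy, hy', ?_⟩
    convert hv using 1
    rw [eq_sub_of_add_eq' key.symm]
    module

/-- A lattice triangle around the origin that has a lattice point inside a side is cut by
it into a smaller triangle around the origin, unless that point is opposite to the third vertex. -/
lemma IsReflexivePolygon.containsMinimalModel_of_triangle (n : ℕ) : ∀ u ∈ latticePoints Q,
    ∀ v ∈ latticePoints Q, ∀ w ∈ latticePoints Q, 0 < cross u v → 0 < cross v w → 0 < cross w u →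
    cross u v + cross v w + cross w u = n → ContainsMinimalModel (latticePoints Q) := by
  induction n using Nat.strong_induction_on with
  | _ n ih =>
    have step : ∀ u ∈ latticePoints Q, ∀ v ∈ latticePoints Q, ∀ w ∈ latticePoints Q,
        0 < cross u v → 0 < cross v w → 0 < cross w u →
        cross u v + cross v w + cross w u = n → 2 ≤ cross u v →
        ContainsMinimalModel (latticePoints Q) := by
      intro u hu v hv w hw huv hvw hwu hn h2
      obtain ⟨y, hy, hy1, hy2, hy3⟩ := h.exists_between hu hv h2
      have hyw : cross y w = - cross w y := by simp only [cross]; ring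
      have key : cross u v * cross y w = cross y v * (-cross w u) + cross u y * cross v w := by
        simp only [cross]; ring
      rcases lt_trichotomy (cross y w) 0 with hlt | heq | hgt
      · refine ih (cross y v + cross v w + cross w y).toNat ?_ y hy v hv w hw hy2 hvw
          (by omega) (by omega)
        have hs : cross u v * (cross y v + cross v w + cross w y) = cross y v * n := by
          rw [← hn]
          linear_combination (-1 : ℤ) * key + cross v w * hy3.symm +
            cross u v * hyw
        have : cross y v + cross v w + cross w y < n := by
          by_contra hc
          nlinarith
        omega
      · rcases h.eq_or_eq_neg hy hw heq with rfl | rfl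
        · have hs : cross u w = -cross w u := by simp only [cross]; ring
          omega
        · exact h.containsMinimalModel_of_neg_mem hy hw
      · refine ih (cross u y + cross y w + cross w u).toNat ?_ u hu y hy w hw hy1 hgt hwu
          (by omega)
        have hs : cross u v * (cross u y + cross y w + cross w u) = cross u y * n := by
          rw [← hn]
          linear_combination key - cross w u * hy3
        have : cross u y + cross y w + cross w u < n := by
          by_contra hc
          nlinarith
        omega
    intro u hu v hv w hw huv hvw hwu hn
    by_cases h1 : 2 ≤ cross u v
    · exact step u hu v hv w hw huv hvw hwu hn h1
    by_cases h2 : 2 ≤ cross v w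
    · exact step v hv w hw u hu hvw hwu huv (by omega) h2
    by_cases h3 : 2 ≤ cross w u
    · exact step w hw u hu v hv hwu huv hvw (by omega) h3
    left
    refine ⟨u, hu, v, hv, by omega, ?_⟩
    convert hw using 1
    have e1 : cross w v = -1 := by
      have : cross w v = -cross v w := by simp only [cross]; ring
      omega
    have e2 : cross u w = -1 := by
      have : cross u w = -cross w u := by simp only [cross]; ring
      omega
    have := cross_smul_eq u v w
    rw [e1, e2, show cross u v = 1 by omega, one_smul] at this
    rw [this]
    module

/-- Every reflexive polygon contains a minimal one. -/
lemma IsReflexivePolygon.containsMinimalModel : ContainsMinimalModel (latticePoints Q) := by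
  obtain ⟨u, hu, -⟩ := h.exists_dot_neg (m := fun _ => 1) (fun h0 => by simpa using congrFun h0 0)
  obtain ⟨v₀, hv₀, hv₀u⟩ := h.exists_cross_pos hu.1
  -- `v` is the last lattice point, in the counterclockwise sense, in the half-plane to the
  -- left of `u`.
  obtain ⟨v, ⟨hv, huv⟩, hmax⟩ := Set.exists_max_image {v ∈ latticePoints Q | 0 < cross u v}
    (fun v => -((u ⬝ᵥ v : ℤ) : ℝ) / ((cross u v : ℤ) : ℝ))
    (h.finite_latticePoints.subset fun _ hx => hx.1) ⟨v₀, hv₀, hv₀u⟩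
  have hlast : ∀ w ∈ latticePoints Q, 0 < cross u w → cross v w ≤ 0 := by
    intro w hw huw
    have hle := hmax w ⟨hw, huw⟩
    have p1 : (0 : ℝ) < ((cross u v : ℤ) : ℝ) := by exact_mod_cast huv
    have p2 : (0 : ℝ) < ((cross u w : ℤ) : ℝ) := by exact_mod_cast huw
    rw [div_le_div_iff₀ p2 p1] at hle
    have hle' : -(u ⬝ᵥ w) * cross u v ≤ -(u ⬝ᵥ v) * cross u w := by exact_mod_cast hle
    have key : (u ⬝ᵥ v) * cross u w - (u ⬝ᵥ w) * cross u v = (u ⬝ᵥ u) * cross v w := by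
      simp only [dot_eq, cross]; ring
    have hpos : 0 < u ⬝ᵥ u := by
      have := dot_self_pos (m := toPlane u) (by simpa using hu.1)
      rw [toPlane_dot] at this
      exact_mod_cast this
    by_contra hc
    nlinarith
  obtain ⟨w, hw, hvw⟩ := h.exists_cross_pos hv.1
  have hwu : cross w u = -cross u w := by simp only [cross]; ring
  rcases lt_trichotomy (cross u w) 0 with hlt | heq | hgt
  · exact h.containsMinimalModel_of_triangle _ u hu v hv w hw huv hvw (by omega)
      (Int.toNat_of_nonneg (by omega)).symm
  · rcases h.eq_or_eq_neg hu hw heq with rfl | rfl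
    · have : cross v w = -cross w v := by simp only [cross]; ring
      omega
    · exact h.containsMinimalModel_of_neg_mem hu hw
  · have := hlast w hw hgt
    omega

end MinimalModels

/-! ### Integral changes of coordinates -/

/-- The linear map of the real plane with a given integral matrix. -/
def linMap (g : GL (Fin 2) ℤ) : Plane →ₗ[ℝ] Plane :=
  Matrix.mulVecLin ((g : Matrix (Fin 2) (Fin 2) ℤ).map (Int.cast : ℤ → ℝ))

lemma linMap_apply (g : GL (Fin 2) ℤ) (x : Plane) :
    linMap g x = ((g : Matrix (Fin 2) (Fin 2) ℤ).map (Int.cast : ℤ → ℝ)) *ᵥ x := rfl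

lemma linMap_coord (g : GL (Fin 2) ℤ) (x : Plane) (i : Fin 2) :
    linMap g x i = (g.val i 0 : ℝ) * x 0 + (g.val i 1 : ℝ) * x 1 := by
  simp only [linMap_apply, mulVec, dot_eq, map_apply]

lemma linMap_toPlane (g : GL (Fin 2) ℤ) (z : Fin 2 → ℤ) :
    linMap g (toPlane z) = toPlane (g.val *ᵥ z) := by
  ext i
  simp only [linMap_coord, mulVec, dot_eq, toPlane_apply]
  push_cast
  ring

lemma linMap_mul (g g' : GL (Fin 2) ℤ) (x : Plane) :
    linMap (g * g') x = linMap g (linMap g' x) := by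
  ext i
  simp only [linMap_coord, Units.val_mul, Matrix.mul_apply, Fin.sum_univ_two]
  push_cast
  ring

lemma linMap_one (x : Plane) : linMap 1 x = x := by
  simp [linMap_apply]

lemma linMap_inv_linMap (g : GL (Fin 2) ℤ) (x : Plane) : linMap g⁻¹ (linMap g x) = x := by
  rw [← linMap_mul, inv_mul_cancel, linMap_one]

lemma linMap_linMap_inv (g : GL (Fin 2) ℤ) (x : Plane) : linMap g (linMap g⁻¹ x) = x := by
  rw [← linMap_mul, mul_inv_cancel, linMap_one]

lemma inv_mulVec_mulVec (g : GL (Fin 2) ℤ) (z : Fin 2 → ℤ) :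
    (g⁻¹).val *ᵥ (g.val *ᵥ z) = z := by
  rw [mulVec_mulVec, ← Units.val_mul, inv_mul_cancel, Units.val_one, one_mulVec]

lemma mulVec_inv_mulVec (g : GL (Fin 2) ℤ) (z : Fin 2 → ℤ) :
    g.val *ᵥ ((g⁻¹).val *ᵥ z) = z := by
  rw [mulVec_mulVec, ← Units.val_mul, mul_inv_cancel, Units.val_one, one_mulVec]

/-- The action of an integral matrix on the dual lattice, through the inverse transpose. -/
def contragredient (g : GL (Fin 2) ℤ) : GL (Fin 2) ℤ where
  val := (g⁻¹).valᵀ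
  inv := g.valᵀ
  val_inv := by rw [← transpose_mul, ← Units.val_mul, mul_inv_cancel]; simp
  inv_val := by rw [← transpose_mul, ← Units.val_mul, inv_mul_cancel]; simp

lemma dot_linMap_inv (g : GL (Fin 2) ℤ) (m x : Plane) :
    m ⬝ᵥ linMap g⁻¹ x = linMap (contragredient g) m ⬝ᵥ x := by
  simp only [dot_eq, linMap_coord, contragredient, Matrix.transpose_apply]
  ring

lemma contragredient_dot_linMap (g : GL (Fin 2) ℤ) (m x : Plane) :
    linMap (contragredient g) m ⬝ᵥ linMap g x = m ⬝ᵥ x := by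
  rw [← dot_linMap_inv, linMap_inv_linMap]

/-- The properties of the nonzero lattice points `S` of a reflexive polygon that are used to
recognise the polygon: no nonzero lattice point of the convex hull is missing, and no nonzero
linear form is nonnegative on `S`. -/
structure IsSaturated (S : Set (Fin 2 → ℤ)) : Prop where
  mem_of_mem_convexHull : ∀ z, z ≠ 0 → toPlane z ∈ convexHull ℝ (toPlane '' S) → z ∈ S
  exists_dot_neg : ∀ m : Plane, m ≠ 0 → ∃ l ∈ S, m ⬝ᵥ toPlane l < 0

lemma IsReflexivePolygon.isSaturated {Q : Set Plane} (h : IsReflexivePolygon Q 0) :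
    IsSaturated (latticePoints Q) where
  mem_of_mem_convexHull z hz hm := ⟨hz, by rwa [← h.eq_convexHull] at hm⟩
  exists_dot_neg _ hm := h.exists_dot_neg hm

lemma linMap_image_convexHull (g : GL (Fin 2) ℤ) (S : Set (Fin 2 → ℤ)) :
    linMap g '' convexHull ℝ (toPlane '' S) =
      convexHull ℝ (toPlane '' ((fun z => g.val *ᵥ z) '' S)) := by
  rw [LinearMap.image_convexHull, image_image, image_image]
  simp only [linMap_toPlane]

lemma IsSaturated.image {S : Set (Fin 2 → ℤ)} (h : IsSaturated S) (g : GL (Fin 2) ℤ) :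
    IsSaturated ((fun z => g.val *ᵥ z) '' S) where
  mem_of_mem_convexHull z hz hm := by
    rw [← linMap_image_convexHull] at hm
    obtain ⟨x, hx, hxz⟩ := hm
    refine ⟨(g⁻¹).val *ᵥ z, h.mem_of_mem_convexHull _ ?_ ?_, mulVec_inv_mulVec g z⟩
    · intro h0
      apply hz
      rw [← mulVec_inv_mulVec g z, h0, mulVec_zero]
    · rw [← linMap_toPlane, ← hxz, linMap_inv_linMap]
      exact hx
  exists_dot_neg m hm := by
    have key : ∀ x, linMap (contragredient g⁻¹) m ⬝ᵥ x = m ⬝ᵥ linMap g x := by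
      intro x
      rw [← dot_linMap_inv, inv_inv]
    obtain ⟨l, hl, hlt⟩ := h.exists_dot_neg (linMap (contragredient g⁻¹) m) (by
      intro h0
      have h1 := key (linMap g⁻¹ m)
      rw [h0, linMap_linMap_inv, zero_dotProduct] at h1
      exact (dot_self_pos hm).ne h1)
    refine ⟨_, ⟨l, hl, rfl⟩, ?_⟩
    rwa [key, linMap_toPlane] at hlt

/-! ### The sixteen models -/

/-- The nonzero lattice points of sixteen reflexive polygons. -/
def modelList : Fin 16 → List (ℤ × ℤ) := ![
  [(-1, -1), (-1, 0), (-1, 1), (-1, 2), (0, -1), (0, 1), (1, -1), (1, 0), (2, -1)],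
  [(-1, -1), (-1, 0), (-1, 1), (0, -1), (0, 1), (1, -1), (1, 0), (1, 1)],
  [(-1, -1), (-1, 0), (-1, 1), (0, -1), (1, -1), (1, 0), (2, -1), (3, -1)],
  [(-1, 0), (-1, 1), (-1, 2), (0, -1), (0, 1), (1, -1), (1, 0), (2, -1)],
  [(-1, 0), (-1, 1), (0, -1), (0, 1), (1, -1), (1, 0), (1, 1)],
  [(-1, 0), (-1, 1), (0, -1), (1, -1), (1, 0), (2, -1), (3, -1)],
  [(-1, 1), (0, -1), (0, 1), (1, -1), (1, 0), (1, 1)],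
  [(-1, 0), (-1, 1), (0, -1), (0, 1), (1, 0), (1, 1)],
  [(-1, 0), (-1, 1), (0, -1), (0, 1), (1, -1), (1, 0)],
  [(-1, 1), (0, -1), (1, -1), (1, 0), (2, -1), (3, -1)],
  [(-1, 1), (0, -1), (0, 1), (1, 0), (1, 1)],
  [(-1, 1), (0, -1), (0, 1), (1, -1), (1, 0)],
  [(-1, 1), (0, -1), (0, 1), (1, 1)],
  [(-1, 1), (0, -1), (0, 1), (1, 0)],
  [(-1, 1), (0, -1), (0, 1), (1, -1)],
  [(-1, 1), (0, -1), (1, 0)]]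

/-- The vertices of the model polygons. -/
def modelVertices : Fin 16 → List (ℤ × ℤ) := ![
  [(-1, -1), (2, -1), (-1, 2)],
  [(-1, -1), (1, -1), (1, 1), (-1, 1)],
  [(-1, -1), (3, -1), (-1, 1)],
  [(-1, 0), (0, -1), (2, -1), (-1, 2)],
  [(-1, 0), (0, -1), (1, -1), (1, 1), (-1, 1)],
  [(-1, 0), (0, -1), (3, -1), (-1, 1)],
  [(-1, 1), (0, -1), (1, -1), (1, 1)],
  [(-1, 0), (0, -1), (1, 0), (1, 1), (-1, 1)],
  [(-1, 0), (0, -1), (1, -1), (1, 0), (0, 1), (-1, 1)],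
  [(-1, 1), (0, -1), (3, -1)],
  [(-1, 1), (0, -1), (1, 0), (1, 1)],
  [(-1, 1), (0, -1), (1, -1), (1, 0), (0, 1)],
  [(-1, 1), (0, -1), (1, 1)],
  [(-1, 1), (0, -1), (1, 0), (0, 1)],
  [(-1, 1), (0, -1), (1, -1), (0, 1)],
  [(-1, 1), (0, -1), (1, 0)]]

/-- The linear forms that are equal to `-1` on a side of the model polygon. -/
def modelNormals : Fin 16 → List (ℤ × ℤ) := ![
  [(0, 1), (-1, -1), (1, 0)],
  [(0, 1), (-1, 0), (0, -1), (1, 0)],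
  [(0, 1), (-1, -2), (1, 0)],
  [(1, 1), (0, 1), (-1, -1), (1, 0)],
  [(1, 1), (0, 1), (-1, 0), (0, -1), (1, 0)],
  [(1, 1), (0, 1), (-1, -2), (1, 0)],
  [(2, 1), (0, 1), (-1, 0), (0, -1)],
  [(1, 1), (-1, 1), (-1, 0), (0, -1), (1, 0)],
  [(1, 1), (0, 1), (-1, 0), (-1, -1), (0, -1), (1, 0)],
  [(2, 1), (0, 1), (-1, -2)],
  [(2, 1), (-1, 1), (-1, 0), (0, -1)],
  [(2, 1), (0, 1), (-1, 0), (-1, -1), (0, -1)],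
  [(2, 1), (-2, 1), (0, -1)],
  [(2, 1), (-1, 1), (-1, -1), (0, -1)],
  [(2, 1), (0, 1), (-2, -1), (0, -1)],
  [(2, 1), (-1, 1), (-1, -2)]]

/-- The rows of the integral matrices that identify a model polygon without one of its vertices
with a smaller model polygon. -/
def cutMatrices : List ((ℤ × ℤ) × (ℤ × ℤ)) :=
  [((-1, -2), (0, 1)), ((-1, -1), (0, -1)), ((-1, -1), (0, 1)), ((-1, -1), (1, 0)),
   ((-1, 0), (0, -1)), ((-1, 0), (0, 1)), ((-1, 0), (1, 1)), ((0, -1), (1, 0)),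
   ((0, -1), (1, 1)), ((0, -1), (1, 2)), ((0, 1), (1, -1)), ((0, 1), (1, 0)),
   ((1, 0), (0, 1)), ((1, 1), (0, -1)), ((1, 2), (-1, -1)), ((2, 1), (-1, -1))]

/-- The product of a linear form and a vector, both given by their coordinates. -/
def pairDot (p q : ℤ × ℤ) : ℤ := p.1 * q.1 + p.2 * q.2

/-- The determinant of two vectors given by their coordinates. -/
def pairCross (p q : ℤ × ℤ) : ℤ := p.1 * q.2 - p.2 * q.1

/-- Cutting a vertex off a model polygon leaves a smaller model polygon, or a polygon that does
not contain the origin in its interior. -/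
lemma cut_vertex : ∀ i, ∀ v ∈ modelVertices i,
    (∃ x ∈ [((1 : ℤ), (0 : ℤ)), (-1, 0), (0, 1), (0, -1), (1, 1), (-1, -1), (-1, 1)],
      ∀ l ∈ modelList i, l ≠ v → 0 ≤ pairDot x l) ∨
    ∃ k, (modelList k).length < (modelList i).length ∧ ∃ g ∈ cutMatrices,
      ∀ l ∈ modelList i, l ≠ v → (pairDot g.1 l, pairDot g.2 l) ∈ modelList k := by
  decide +kernel

lemma cutMatrices_det : ∀ g ∈ cutMatrices, pairCross g.1 g.2 = 1 ∨ pairCross g.1 g.2 = -1 := by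
  decide +kernel

/-- Every lattice point of a model polygon is on a segment between two vertices, with small
integral weights. -/
lemma modelList_between_vertices : ∀ i, ∀ a ∈ modelList i, ∃ u ∈ modelVertices i,
    ∃ w ∈ modelVertices i, ∃ m ∈ List.range 4, ∃ n ∈ List.range 4, 0 < m + n ∧
      ((m + n : ℤ) * a.1 = m * u.1 + n * w.1 ∧ (m + n : ℤ) * a.2 = m * u.2 + n * w.2) := by
  decide +kernel

lemma modelList_bounds : ∀ i, ∀ a ∈ modelList i,
    a ≠ (0, 0) ∧ (-1 ≤ a.1 ∧ a.1 ≤ 3) ∧ -1 ≤ a.2 ∧ a.2 ≤ 3 := by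
  decide +kernel

/-- The lattice points of a model polygon surround the origin. -/
lemma modelList_positive_span : ∀ i,
    (∃ u ∈ modelList i, ∃ v ∈ modelList i, ∃ w ∈ modelList i,
      0 < pairCross u v ∧ 0 < pairCross v w ∧ 0 < pairCross w u) ∨
    ∃ u ∈ modelList i, ∃ v ∈ modelList i, 0 < pairCross u v ∧ -u ∈ modelList i ∧
      -v ∈ modelList i := by
  decide +kernel

/-- The nonzero lattice points of the square `[-1, 3]²` are on the boundary of the model polygon
or outside of it. -/
lemma modelNormals_separate : ∀ i, ∀ a ∈ List.range 5, ∀ b ∈ List.range 5,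
    ((a : ℤ) - 1, (b : ℤ) - 1) ≠ (0, 0) → ∃ l ∈ modelNormals i,
      (∀ q ∈ modelList i, -1 ≤ pairDot l q) ∧ pairDot l ((a : ℤ) - 1, (b : ℤ) - 1) ≤ -1 ∧
      (((a : ℤ) - 1, (b : ℤ) - 1) ∈ modelList i ∨
        pairDot l ((a : ℤ) - 1, (b : ℤ) - 1) ≤ -2) := by
  decide +kernel

/-- Three numbers that do not change under additive isomorphisms: the number of elements, of pairs
with sum in the set, and of elements with negative in the set. -/
def additiveInvariants {M : Type*} [AddCommGroup M] [DecidableEq M] (A : Finset M) : ℕ × ℕ × ℕ :=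
  (A.card, ((A ×ˢ A).filter fun p => p.1 + p.2 ∈ A).card, (A.filter fun p => -p ∈ A).card)

lemma additiveInvariants_modelList : ∀ i, additiveInvariants (modelList i).toFinset =
    (![(9, 30, 6), (8, 24, 8), (8, 20, 4), (8, 24, 6), (7, 18, 6), (7, 16, 4), (6, 10, 4),
      (6, 12, 4), (6, 12, 6), (6, 8, 2), (5, 6, 2), (5, 6, 4), (4, 0, 2), (4, 2, 2), (4, 0, 4),
      (3, 0, 0)] : Fin 16 → ℕ × ℕ × ℕ) i := by
  decide +kernel

lemma additiveInvariants_injective :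
    Function.Injective fun i : Fin 16 => additiveInvariants (modelList i).toFinset := by
  intro i j hij
  simp only [additiveInvariants_modelList] at hij
  revert i j
  decide +kernel

/-! ### The classification of reflexive polygons -/

lemma extremePoints_image (L : Plane →ₗ[ℝ] Plane) (hL : Function.Injective L) (b : Plane)
    (K : Set Plane) : ((fun x => L x + b) '' K).extremePoints ℝ =
      (fun x => L x + b) '' K.extremePoints ℝ := by
  have hinj : Function.Injective fun x => L x + b := fun x y hxy => hL (add_right_cancel hxy)
  have hseg : ∀ x y : Plane, (fun x => L x + b) '' openSegment ℝ x y =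
      openSegment ℝ (L x + b) (L y + b) := by
    intro x y
    have := image_openSegment ℝ (L.toAffineMap + AffineMap.const ℝ Plane b) x y
    exact this
  ext z
  constructor
  · rintro ⟨⟨x, hx, rfl⟩, h⟩
    refine ⟨x, ⟨hx, fun y₁ h₁ y₂ h₂ hs => hinj (h ⟨y₁, h₁, rfl⟩ ⟨y₂, h₂, rfl⟩ ?_)⟩, rfl⟩
    rw [← hseg]
    exact ⟨x, hs, rfl⟩
  · rintro ⟨x, hx, rfl⟩
    refine ⟨⟨x, hx.1, rfl⟩, ?_⟩
    rintro _ ⟨y₁, h₁, rfl⟩ _ ⟨y₂, h₂, rfl⟩ hs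
    rw [← hseg] at hs
    obtain ⟨x', hx', he⟩ := hs
    have he' : x' = x := hinj he
    rw [hx.2 h₁ h₂ (he' ▸ hx')]

lemma linMap_injective (g : GL (Fin 2) ℤ) : Function.Injective (linMap g) :=
  Function.LeftInverse.injective (linMap_inv_linMap g)

/-- The tropical isomorphism with linear part `g` and translation vector `b`. -/
def tropicalHomeomorph (g : GL (Fin 2) ℤ) (b : Plane) : Plane ≃ₜ Plane where
  toFun x := linMap g x + b
  invFun x := linMap g⁻¹ (x - b)
  left_inv x := by simp [linMap_inv_linMap]
  right_inv x := by simp [linMap_linMap_inv]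
  continuous_toFun := (LinearMap.continuous_of_finiteDimensional (linMap g)).add continuous_const
  continuous_invFun := (LinearMap.continuous_of_finiteDimensional (linMap g⁻¹)).comp
    (continuous_id.sub continuous_const)

lemma coe_tropicalHomeomorph (g : GL (Fin 2) ℤ) (b : Plane) :
    ⇑(tropicalHomeomorph g b) = fun x => linMap g x + b := rfl

lemma exists_gl_of_rows (u v : Fin 2 → ℤ) (h : cross u v = 1 ∨ cross u v = -1) :
    ∃ g : GL (Fin 2) ℤ, ∀ z, g.val *ᵥ z = ![u ⬝ᵥ z, v ⬝ᵥ z] := by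
  have hdet : IsUnit (!![u 0, u 1; v 0, v 1]).det := by
    rw [det_fin_two_of, Int.isUnit_iff]
    simpa only [cross] using h
  refine ⟨Matrix.nonsingInvUnit _ hdet, fun z => ?_⟩
  ext i
  fin_cases i <;> rfl

/-- Pairs of integers as lattice vectors. -/
def pairEquiv : ℤ × ℤ ≃+ (Fin 2 → ℤ) where
  toFun p := ![p.1, p.2]
  invFun z := (z 0, z 1)
  left_inv _ := rfl
  right_inv z := by ext i; fin_cases i <;> rfl
  map_add' p q := by ext i; fin_cases i <;> rfl

@[simp] lemma pairEquiv_zero (p : ℤ × ℤ) : pairEquiv p 0 = p.1 := rfl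

@[simp] lemma pairEquiv_one (p : ℤ × ℤ) : pairEquiv p 1 = p.2 := rfl

/-- The nonzero lattice points of a model polygon. -/
def modelPoints (i : Fin 16) : Finset (Fin 2 → ℤ) := (modelList i).toFinset.image pairEquiv

/-- The model polygons. -/
def model (i : Fin 16) : Set Plane := convexHull ℝ (toPlane '' (modelPoints i : Set (Fin 2 → ℤ)))

lemma mem_modelPoints {i : Fin 16} {z : Fin 2 → ℤ} :
    z ∈ modelPoints i ↔ (z 0, z 1) ∈ modelList i := by
  rw [modelPoints, Finset.mem_image]
  constructor
  · rintro ⟨p, hp, rfl⟩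
    exact List.mem_toFinset.1 hp
  · intro hz
    exact ⟨(z 0, z 1), List.mem_toFinset.2 hz, pairEquiv.right_inv z⟩

lemma toPlane_mem_model {i : Fin 16} {z : Fin 2 → ℤ} (hz : z ∈ modelPoints i) :
    toPlane z ∈ model i := subset_convexHull ℝ _ ⟨z, hz, rfl⟩

lemma pairDot_le_dot_of_mem_model {i : Fin 16} {l : ℤ × ℤ} {c : ℤ}
    (hl : ∀ q ∈ modelList i, c ≤ pairDot l q) {x : Plane} (hx : x ∈ model i) :
    (c : ℝ) ≤ toPlane (pairEquiv l) ⬝ᵥ x := by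
  refine dot_ge_of_mem_convexHull ?_ hx
  rintro _ ⟨z, hz, rfl⟩
  have := hl _ (mem_modelPoints.1 hz)
  rw [toPlane_dot, dot_eq]
  exact_mod_cast this

lemma model_lattice_separate {i : Fin 16} {z : Fin 2 → ℤ} (hz : z ≠ 0)
    (hm : toPlane z ∈ model i) : z ∈ modelPoints i ∧ toPlane z ∉ interior (model i) := by
  have hb := modelList_bounds i
  have b1 := pairDot_le_dot_of_mem_model (i := i) (l := (1, 0)) (c := -1)
    (fun q hq => by simpa [pairDot] using (hb q hq).2.1.1) hm
  have b2 := pairDot_le_dot_of_mem_model (i := i) (l := (0, 1)) (c := -1)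
    (fun q hq => by simpa [pairDot] using (hb q hq).2.2.1) hm
  have b3 := pairDot_le_dot_of_mem_model (i := i) (l := (-1, 0)) (c := -3)
    (fun q hq => by simpa [pairDot] using (hb q hq).2.1.2) hm
  have b4 := pairDot_le_dot_of_mem_model (i := i) (l := (0, -1)) (c := -3)
    (fun q hq => by simpa [pairDot] using (hb q hq).2.2.2) hm
  rw [toPlane_dot, Int.cast_le, dot_eq] at b1 b2 b3 b4
  simp only [pairEquiv_zero, pairEquiv_one, one_mul, zero_mul, zero_add, add_zero, neg_mul]
    at b1 b2 b3 b4
  have ha : (((z 0 + 1).toNat : ℕ) : ℤ) - 1 = z 0 := by omega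
  have hbb : (((z 1 + 1).toNat : ℕ) : ℤ) - 1 = z 1 := by omega
  obtain ⟨l, hl, hge, hle, hor⟩ := modelNormals_separate i (z 0 + 1).toNat
    (List.mem_range.2 (by omega)) (z 1 + 1).toNat (List.mem_range.2 (by omega)) (by
      rw [ha, hbb]
      intro h0
      simp only [Prod.mk.injEq] at h0
      apply hz
      ext j; fin_cases j
      · exact h0.1
      · exact h0.2)
  rw [ha, hbb] at hle hor
  have hd : ∀ y ∈ model i, ((-1 : ℤ) : ℝ) ≤ toPlane (pairEquiv l) ⬝ᵥ y :=
    fun y hy => pairDot_le_dot_of_mem_model hge hy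
  have hz' : toPlane (pairEquiv l) ⬝ᵥ toPlane z = ((pairDot l (z 0, z 1) : ℤ) : ℝ) := by
    rw [toPlane_dot, dot_eq]; rfl
  constructor
  · refine mem_modelPoints.2 (hor.resolve_right fun h2 => ?_)
    have h1 := hd _ hm
    rw [hz'] at h1
    have : -1 ≤ pairDot l (z 0, z 1) := by exact_mod_cast h1
    omega
  · intro hi
    obtain ⟨y, hy, hlt⟩ := exists_dot_lt_of_mem_interior hi (m := toPlane (pairEquiv l)) (by
      intro h0
      have h1 := hd _ hm
      rw [toPlane_eq_zero] at h0
      have h2 : l = 0 := by simpa using h0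
      rw [h2] at hle
      simp [pairDot] at hle)
    rw [hz'] at hlt
    have h1 := hd _ hy
    have h2 : ((-1 : ℤ) : ℝ) < ((pairDot l (z 0, z 1) : ℤ) : ℝ) := h1.trans_lt hlt
    have : -1 < pairDot l (z 0, z 1) := by exact_mod_cast h2
    omega

lemma eq_zero_of_dot_eq_zero {m : Plane} {u v : Fin 2 → ℤ} (huv : cross u v ≠ 0)
    (hu : m ⬝ᵥ toPlane u = 0) (hv : m ⬝ᵥ toPlane v = 0) : m = 0 := by
  have hne : ((cross u v : ℤ) : ℝ) ≠ 0 := by exact_mod_cast huv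
  simp only [cross] at hne
  push_cast at hne
  rw [dot_eq] at hu hv
  simp only [toPlane_apply] at hu hv
  ext i
  apply mul_left_cancel₀ hne
  fin_cases i <;> simp only [Fin.zero_eta, Fin.mk_one, Pi.zero_apply, mul_zero]
  · linear_combination (v 1 : ℝ) * hu - (u 1 : ℝ) * hv
  · linear_combination -(v 0 : ℝ) * hu + (u 0 : ℝ) * hv

lemma zero_mem_interior_model (i : Fin 16) : (0 : Plane) ∈ interior (model i) := by
  by_contra h0
  obtain ⟨m, hm, hge⟩ := exists_dot_nonneg (convex_convexHull ℝ _) h0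
  have hge' : ∀ p ∈ modelList i, 0 ≤ m ⬝ᵥ toPlane (pairEquiv p) := fun p hp =>
    hge _ (toPlane_mem_model (mem_modelPoints.2 hp))
  have hcr : ∀ p q, pairCross p q = cross (pairEquiv p) (pairEquiv q) := fun p q => rfl
  apply hm
  rcases modelList_positive_span i with ⟨u, hu, v, hv, w, hw, huv, hvw, hwu⟩ |
    ⟨u, hu, v, hv, huv, hu', hv'⟩
  · rw [hcr] at huv hvw hwu
    have gu := hge' u hu
    have gv := hge' v hv
    have gw := hge' w hw
    -- The three vectors have a linear relation with positive coefficients.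
    have key : ((cross (pairEquiv v) (pairEquiv w) : ℤ) : ℝ) * m ⬝ᵥ toPlane (pairEquiv u) +
        ((cross (pairEquiv w) (pairEquiv u) : ℤ) : ℝ) * m ⬝ᵥ toPlane (pairEquiv v) +
        ((cross (pairEquiv u) (pairEquiv v) : ℤ) : ℝ) * m ⬝ᵥ toPlane (pairEquiv w) = 0 := by
      simp only [dot_eq, toPlane_apply, cross]
      push_cast
      ring
    have p1 : (0 : ℝ) < ((cross (pairEquiv v) (pairEquiv w) : ℤ) : ℝ) := by exact_mod_cast hvw
    have p2 : (0 : ℝ) < ((cross (pairEquiv w) (pairEquiv u) : ℤ) : ℝ) := by exact_mod_cast hwu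
    have p3 : (0 : ℝ) < ((cross (pairEquiv u) (pairEquiv v) : ℤ) : ℝ) := by exact_mod_cast huv
    have q1 := mul_nonneg p1.le gu
    have q2 := mul_nonneg p2.le gv
    have q3 := mul_nonneg p3.le gw
    refine eq_zero_of_dot_eq_zero (u := pairEquiv u) (v := pairEquiv v) huv.ne' ?_ ?_
    · exact (mul_eq_zero.1 (by linarith)).resolve_left p1.ne'
    · exact (mul_eq_zero.1 (by linarith)).resolve_left p2.ne'
  · rw [hcr] at huv
    have gu := hge' u hu
    have gv := hge' v hv
    have gu' := hge' _ hu'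
    have gv' := hge' _ hv'
    rw [map_neg, toPlane_neg, dotProduct_neg] at gu' gv'
    exact eq_zero_of_dot_eq_zero (u := pairEquiv u) (v := pairEquiv v) huv.ne'
      (by linarith) (by linarith)

lemma isReflexivePolygon_model (i : Fin 16) : IsReflexivePolygon (model i) 0 := by
  refine ⟨⟨modelPoints i, rfl⟩, ?_⟩
  ext z
  simp only [mem_ofPred_eq, mem_singleton_iff]
  constructor
  · intro hz
    by_contra h0
    exact (model_lattice_separate h0 (interior_subset hz)).2 hz
  · rintro rfl
    rw [toPlane_zero]
    exact zero_mem_interior_model i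

lemma latticePoints_model (i : Fin 16) : latticePoints (model i) = modelPoints i := by
  ext z
  constructor
  · exact fun hz => (model_lattice_separate hz.1 hz.2).1
  · intro hz
    refine ⟨?_, toPlane_mem_model hz⟩
    rintro rfl
    exact (modelList_bounds i _ (mem_modelPoints.1 hz)).1 rfl

/-- A saturated subset of a model either is everything or misses a vertex; in the second case it
is contained in a smaller model. -/
lemma IsSaturated.exists_model (n : ℕ) : ∀ (i : Fin 16) (S : Set (Fin 2 → ℤ)),
    (modelList i).length = n → IsSaturated S → S ⊆ modelPoints i →
    ∃ (k : Fin 16) (g : GL (Fin 2) ℤ), (fun z => g.val *ᵥ z) '' S = modelPoints k := by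
  induction n using Nat.strong_induction_on with
  | _ n ih =>
    intro i S hn hS hsub
    by_cases hall : ∀ v ∈ modelVertices i, pairEquiv v ∈ S
    · refine ⟨i, 1, ?_⟩
      simp only [Units.val_one, one_mulVec, image_id']
      refine subset_antisymm hsub fun z hz => ?_
      have hz' := mem_modelPoints.1 (Finset.mem_coe.1 hz)
      obtain ⟨u, hu, w, hw, a, -, b, -, hab, h1, h2⟩ := modelList_between_vertices i _ hz'
      have hz0 : z ≠ 0 := by
        rintro rfl
        exact (modelList_bounds i _ hz').1 rfl
      refine hS.mem_of_mem_convexHull z hz0 ?_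
      have hab' : (0 : ℝ) < (a : ℝ) + b := by exact_mod_cast hab
      have e : toPlane z = ((a : ℝ) / (a + b)) • toPlane (pairEquiv u) +
          ((b : ℝ) / (a + b)) • toPlane (pairEquiv w) := by
        have h1' : ((a : ℝ) + b) * z 0 = a * u.1 + b * w.1 := by exact_mod_cast h1
        have h2' : ((a : ℝ) + b) * z 1 = a * u.2 + b * w.2 := by exact_mod_cast h2
        ext j
        fin_cases j <;> simp <;> field_simp <;> linarith
      rw [e]
      refine (convex_convexHull ℝ (toPlane '' S)) (subset_convexHull ℝ _ ⟨_, hall u hu, rfl⟩)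
        (subset_convexHull ℝ _ ⟨_, hall w hw, rfl⟩) (by positivity) (by positivity) ?_
      rw [← add_div, div_self hab'.ne']
    · push Not at hall
      obtain ⟨v, hv, hvS⟩ := hall
      have hrest : ∀ z ∈ S, (z 0, z 1) ∈ modelList i ∧ (z 0, z 1) ≠ v := by
        intro z hz
        refine ⟨mem_modelPoints.1 (hsub hz), ?_⟩
        rintro rfl
        exact hvS (by convert hz using 1; exact pairEquiv.right_inv z)
      rcases cut_vertex i v hv with ⟨x, hx, hge⟩ | ⟨k, hk, g, hg, hmem⟩
      · exfalso
        have hx0 : pairEquiv x ≠ 0 := by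
          have : ∀ y ∈ [((1 : ℤ), (0 : ℤ)), (-1, 0), (0, 1), (0, -1), (1, 1), (-1, -1), (-1, 1)],
            y ≠ 0 := by decide
          simpa using this x hx
        obtain ⟨l, hl, hlt⟩ := hS.exists_dot_neg (toPlane (pairEquiv x)) (by simpa using hx0)
        have := hge _ (hrest l hl).1 (hrest l hl).2
        rw [toPlane_dot, dot_eq] at hlt
        have h2 : pairDot x (l 0, l 1) < 0 := by exact_mod_cast hlt
        omega
      · obtain ⟨γ, hγ⟩ := exists_gl_of_rows (pairEquiv g.1) (pairEquiv g.2) (cutMatrices_det g hg)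
        obtain ⟨k', γ', h'⟩ := ih _ (hn ▸ hk) k _ rfl (hS.image γ) (by
          rintro _ ⟨z, hz, rfl⟩
          rw [Finset.mem_coe, mem_modelPoints]
          simp only [hγ]
          have := hmem _ (hrest z hz).1 (hrest z hz).2
          simp only [cons_val_zero, cons_val_one, dot_eq]
          exact this)
        refine ⟨k', γ' * γ, ?_⟩
        rw [← h', image_image]
        simp only [Units.val_mul, mulVec_mulVec]

/-- A reflexive polygon is contained in one of the three largest models, as its dual contains one
of the three minimal reflexive polygons. -/
lemma IsReflexivePolygon.exists_subset_model {K : Set Plane} (h : IsReflexivePolygon K 0) :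
    ∃ (i : Fin 16) (g : GL (Fin 2) ℤ),
      (fun z => g.val *ᵥ z) '' latticePoints K ⊆ modelPoints i := by
  have hdot : ∀ l ∈ latticePoints (dualPolygon K 0), ∀ z ∈ latticePoints K, -1 ≤ l ⬝ᵥ z := by
    intro l hl z hz
    have := mem_dualPolygon_zero.1 hl.2 _ hz.2
    rw [toPlane_dot] at this
    exact_mod_cast this
  have hne : ∀ {u v z : Fin 2 → ℤ}, cross u v ≠ 0 → z ≠ 0 → u ⬝ᵥ z = 0 → v ⬝ᵥ z = 0 → False := by
    intro u v z huv hz hu hv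
    refine hz (toPlane_eq_zero.1 (eq_zero_of_dot_eq_zero huv ?_ ?_))
    · rw [dotProduct_comm, toPlane_dot, hu, Int.cast_zero]
    · rw [dotProduct_comm, toPlane_dot, hv, Int.cast_zero]
  rcases h.dual.containsMinimalModel with ⟨u, hu, v, hv, huv, hw⟩ | ⟨u, hu, v, hv, huv, hu', hv'⟩ |
    ⟨u, hu, y, hy, huy, hy', hw⟩
  · obtain ⟨g, hg⟩ := exists_gl_of_rows u v (Or.inl huv)
    refine ⟨0, g, ?_⟩
    rintro _ ⟨z, hz, rfl⟩
    rw [Finset.mem_coe, mem_modelPoints]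
    simp only [hg, cons_val_zero, cons_val_one]
    have h1 := hdot u hu z hz
    have h2 := hdot v hv z hz
    have h3 := hdot _ hw z hz
    have h4 := hne (huv ▸ one_ne_zero) hz.1
    rw [neg_dotProduct, add_dotProduct] at h3
    generalize u ⬝ᵥ z = a at *
    generalize v ⬝ᵥ z = b at *
    have ha : a ≤ 2 := by omega
    have hb : b ≤ 2 := by omega
    interval_cases a <;> interval_cases b <;> first | (exfalso; omega) | (exfalso; tauto) | decide
  · obtain ⟨g, hg⟩ := exists_gl_of_rows u v (Or.inl huv)
    refine ⟨1, g, ?_⟩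
    rintro _ ⟨z, hz, rfl⟩
    rw [Finset.mem_coe, mem_modelPoints]
    simp only [hg, cons_val_zero, cons_val_one]
    have h1 := hdot u hu z hz
    have h2 := hdot v hv z hz
    have h3 := hdot _ hu' z hz
    have h3' := hdot _ hv' z hz
    have h4 := hne (huv ▸ one_ne_zero) hz.1
    rw [neg_dotProduct] at h3 h3'
    generalize u ⬝ᵥ z = a at *
    generalize v ⬝ᵥ z = b at *
    have ha : a ≤ 1 := by omega
    have hb : b ≤ 1 := by omega
    interval_cases a <;> interval_cases b <;> first | (exfalso; tauto) | decide
  · have hcr : cross u (-y) = -1 := by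
      rw [← huy]; simp only [cross, Pi.neg_apply]; ring
    obtain ⟨g, hg⟩ := exists_gl_of_rows u (-y) (Or.inr hcr)
    refine ⟨2, g, ?_⟩
    rintro _ ⟨z, hz, rfl⟩
    rw [Finset.mem_coe, mem_modelPoints]
    simp only [hg, cons_val_zero, cons_val_one]
    have h1 := hdot u hu z hz
    have h2 := hdot y hy z hz
    have h3 := hdot _ hy' z hz
    have h3' := hdot _ hw z hz
    have h4 := hne (huy ▸ one_ne_zero) hz.1
    rw [neg_dotProduct] at h3 ⊢
    rw [sub_dotProduct, smul_dotProduct, nsmul_eq_mul, Nat.cast_ofNat] at h3'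
    generalize u ⬝ᵥ z = a at *
    generalize y ⬝ᵥ z = b at *
    have ha : a ≤ 3 := by omega
    have hb : b ≤ 1 := by omega
    interval_cases a <;> interval_cases b <;> first | (exfalso; omega) | (exfalso; tauto) | decide

/-- Every reflexive polygon with interior lattice point at the origin is a model, up to an
integral change of coordinates. -/
lemma IsReflexivePolygon.exists_model {K : Set Plane} (h : IsReflexivePolygon K 0) :
    ∃ (i : Fin 16) (g : GL (Fin 2) ℤ), linMap g '' K = model i := by
  obtain ⟨i, g, hg⟩ := h.exists_subset_model
  obtain ⟨k, g', hg'⟩ := (h.isSaturated.image g).exists_model _ i _ rfl hg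
  refine ⟨k, g' * g, ?_⟩
  rw [h.eq_convexHull, linMap_image_convexHull, model, ← hg']
  simp only [image_image, Units.val_mul, mulVec_mulVec]

lemma additiveInvariants_image {M M' : Type*} [AddCommGroup M] [AddCommGroup M'] [DecidableEq M]
    [DecidableEq M'] (e : M ≃+ M') (A : Finset M) :
    additiveInvariants (A.image e) = additiveInvariants A := by
  simp only [additiveInvariants, Prod.mk.injEq]
  refine ⟨Finset.card_image_of_injective _ e.injective, ?_, ?_⟩
  · have hp : Function.Injective (Prod.map e e) := e.injective.prodMap e.injective
    rw [← Finset.prodMap_image_product, Finset.filter_image, Finset.card_image_of_injective _ hp]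
    congr 1
    refine Finset.filter_congr fun p _ => ?_
    simp only [Prod.map_fst, Prod.map_snd, ← map_add, e.injective.mem_finset_image]
  · rw [Finset.filter_image, Finset.card_image_of_injective _ e.injective]
    congr 1
    refine Finset.filter_congr fun p _ => ?_
    simp only [← map_neg, e.injective.mem_finset_image]

/-- A matrix in `GL₂(ℤ)` as an automorphism of the lattice. -/
def latticeEquiv (g : GL (Fin 2) ℤ) : (Fin 2 → ℤ) ≃+ (Fin 2 → ℤ) where
  toFun z := g.val *ᵥ z
  invFun z := (g⁻¹).val *ᵥ z
  left_inv := inv_mulVec_mulVec g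
  right_inv := mulVec_inv_mulVec g
  map_add' := mulVec_add _

lemma model_linMap_injective {i j : Fin 16} {g : GL (Fin 2) ℤ}
    (h : linMap g '' model i = model j) : i = j := by
  have himg : (modelPoints i).image (latticeEquiv g) = modelPoints j := by
    apply Finset.coe_injective
    rw [Finset.coe_image, ← latticePoints_model, ← latticePoints_model]
    ext z
    constructor
    · rintro ⟨y, hy, rfl⟩
      refine ⟨?_, ?_⟩
      · simpa using hy.1
      · rw [← h]
        exact ⟨_, hy.2, linMap_toPlane g y⟩
    · intro hz
      refine ⟨(latticeEquiv g).symm z, ⟨by simpa using hz.1, ?_⟩, by simp⟩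
      have := hz.2
      rw [← h] at this
      obtain ⟨x, hx, hxz⟩ := this
      have : toPlane ((latticeEquiv g).symm z) = x := by
        apply linMap_injective g
        rw [linMap_toPlane, hxz]
        exact congrArg toPlane (mulVec_inv_mulVec g z)
      rwa [this]
  apply additiveInvariants_injective
  have e1 := additiveInvariants_image (latticeEquiv g) (modelPoints i)
  rw [himg, modelPoints, modelPoints, additiveInvariants_image, additiveInvariants_image] at e1
  exact e1.symm

lemma model_injective {i j : Fin 16} (h : TropicallyIsomorphic (model i) (model j)) : i = j := by
  obtain ⟨f, ⟨g, b, hf⟩, hij⟩ := h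
  have hf' : f = fun x => linMap g x + b := funext hf
  subst hf'
  -- A vertex goes to a vertex, so that the translation vector is integral.
  obtain ⟨v, hv⟩ := (isReflexivePolygon_model i).isCompact.extremePoints_nonempty
    ⟨0, interior_subset (zero_mem_interior_model i)⟩
  have hv' : linMap g v + b ∈ (model j).extremePoints ℝ := by
    rw [← hij, extremePoints_image _ (linMap_injective g)]
    exact ⟨v, hv, rfl⟩
  obtain ⟨z, -, rfl⟩ := extremePoints_convexHull_subset hv
  obtain ⟨y, -, hy⟩ := extremePoints_convexHull_subset hv'
  have hb : b = toPlane (y - g.val *ᵥ z) := by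
    rw [linMap_toPlane] at hy
    rw [sub_eq_add_neg, toPlane_add, toPlane_neg, hy]
    abel
  -- It is the image of the origin, hence an interior lattice point.
  have hint : b ∈ interior (model j) := by
    rw [← hij, ← coe_tropicalHomeomorph, ← Homeomorph.image_interior]
    exact ⟨0, zero_mem_interior_model i, by simp [coe_tropicalHomeomorph]⟩
  have hb0 : b = 0 := by
    rw [hb] at hint ⊢
    rw [(isReflexivePolygon_model j).eq_zero hint, toPlane_zero]
  refine model_linMap_injective (g := g) ?_
  simpa [hb0] using hij

/-! ### Dual cones at the vertices -/

lemma primitive_of_combination {z : Fin 2 → ℤ} {a b : ℤ} (h : a * z 0 + b * z 1 = 1) :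
    Primitive z :=
  Int.isCoprime_iff_gcd_eq_one.1 ⟨a, b, h⟩

/-- A ray contains at most one primitive vector. -/
lemma Primitive.eq_of_toPlane_eq_smul {l m : Fin 2 → ℤ} (hl : Primitive l) (hm : Primitive m)
    {c : ℝ} (hc : 0 < c) (h : toPlane l = c • toPlane m) : l = m := by
  have e0 : (l 0 : ℝ) = c * m 0 := congrFun h 0
  have e1 : (l 1 : ℝ) = c * m 1 := congrFun h 1
  have hcr : l 0 * m 1 = l 1 * m 0 := by
    have : (l 0 : ℝ) * m 1 = l 1 * m 0 := by rw [e0, e1]; ring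
    exact_mod_cast this
  obtain ⟨x, y, hxy⟩ := Int.isCoprime_iff_gcd_eq_one.2 hm
  -- Bézout coefficients of `m` show that the proportionality factor is an integer.
  obtain ⟨k, hk⟩ : ∃ k : ℤ, k = x * l 0 + y * l 1 := ⟨_, rfl⟩
  have k0 : l 0 = k * m 0 := by rw [hk]; linear_combination (-(l 0)) * hxy + y * hcr
  have k1 : l 1 = k * m 1 := by rw [hk]; linear_combination (-(l 1)) * hxy - x * hcr
  have hk1 : k.natAbs = 1 := by
    have : Int.gcd (l 0) (l 1) = 1 := hl
    rw [k0, k1, Int.gcd_mul_left, show Int.gcd (m 0) (m 1) = 1 from hm, mul_one] at this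
    exact this
  rcases Int.natAbs_eq_iff.1 hk1 with hk' | hk'
  · ext i
    fin_cases i
    · simpa [hk'] using k0
    · simpa [hk'] using k1
  · exfalso
    rw [hk'] at k0 k1
    rw [k0] at e0
    rw [k1] at e1
    push_cast at e0 e1
    have h0 : (m 0 : ℝ) = 0 := (mul_eq_zero.1
      (by linear_combination -e0 : (c + 1) * (m 0 : ℝ) = 0)).resolve_left (by linarith)
    have h1 : (m 1 : ℝ) = 0 := (mul_eq_zero.1
      (by linear_combination -e1 : (c + 1) * (m 1 : ℝ) = 0)).resolve_left (by linarith)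
    have h0' : m 0 = 0 := by exact_mod_cast h0
    have h1' : m 1 = 0 := by exact_mod_cast h1
    rw [h0', h1'] at hxy
    simp at hxy

lemma eq_coeff_of_cross_ne_zero {l m : Plane} (h : cross l m ≠ 0) {a b a' b' : ℝ}
    (he : a • l + b • m = a' • l + b' • m) : a = a' ∧ b = b' := by
  have e0 : a * l 0 + b * m 0 = a' * l 0 + b' * m 0 := congrFun he 0
  have e1 : a * l 1 + b * m 1 = a' * l 1 + b' * m 1 := congrFun he 1
  constructor
  · apply mul_right_cancel₀ h
    simp only [cross]
    linear_combination m 1 * e0 - m 0 * e1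
  · apply mul_right_cancel₀ h
    simp only [cross]
    linear_combination l 0 * e1 - l 1 * e0

/-- The determinant of a strictly convex rational cone does not depend on the choice of its
primitive generators. -/
lemma natAbs_cross_eq_of_cone_eq {l m l' m' : Fin 2 → ℤ} (hl : Primitive l) (hm : Primitive m)
    (hl' : Primitive l') (hm' : Primitive m') (hlm : cross l m ≠ 0)
    (h : {x | ∃ a b : ℝ, 0 ≤ a ∧ 0 ≤ b ∧ x = a • toPlane l + b • toPlane m} =
      {x | ∃ a b : ℝ, 0 ≤ a ∧ 0 ≤ b ∧ x = a • toPlane l' + b • toPlane m'}) :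
    (cross l' m').natAbs = (cross l m).natAbs := by
  have hR : cross (toPlane l) (toPlane m) ≠ 0 := by
    rw [cross_toPlane]; exact_mod_cast hlm
  obtain ⟨a, b, ha, hb, h1⟩ : toPlane l' ∈
      {x | ∃ a b : ℝ, 0 ≤ a ∧ 0 ≤ b ∧ x = a • toPlane l + b • toPlane m} := by
    rw [h]; exact ⟨1, 0, zero_le_one, le_rfl, by simp⟩
  obtain ⟨c, d, hc, hd, h2⟩ : toPlane m' ∈
      {x | ∃ a b : ℝ, 0 ≤ a ∧ 0 ≤ b ∧ x = a • toPlane l + b • toPlane m} := by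
    rw [h]; exact ⟨0, 1, le_rfl, zero_le_one, by simp⟩
  obtain ⟨a', b', ha', hb', h3⟩ : toPlane l ∈
      {x | ∃ a b : ℝ, 0 ≤ a ∧ 0 ≤ b ∧ x = a • toPlane l' + b • toPlane m'} := by
    rw [← h]; exact ⟨1, 0, zero_le_one, le_rfl, by simp⟩
  obtain ⟨c', d', hc', hd', h4⟩ : toPlane m ∈
      {x | ∃ a b : ℝ, 0 ≤ a ∧ 0 ≤ b ∧ x = a • toPlane l' + b • toPlane m'} := by
    rw [← h]; exact ⟨0, 1, le_rfl, zero_le_one, by simp⟩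
  -- The two nonnegative matrices of coefficients are inverse to each other, hence monomial.
  obtain ⟨e1, e2⟩ := eq_coeff_of_cross_ne_zero hR (a := a' * a + b' * c) (b := a' * b + b' * d)
    (a' := 1) (b' := 0) (by
      rw [h1, h2] at h3
      rw [one_smul, zero_smul, add_zero]
      conv_rhs => rw [h3]
      module)
  obtain ⟨e3, e4⟩ := eq_coeff_of_cross_ne_zero hR (a := c' * a + d' * c) (b := c' * b + d' * d)
    (a' := 0) (b' := 1) (by
      rw [h1, h2] at h4
      rw [one_smul, zero_smul, zero_add]
      conv_rhs => rw [h4]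
      module)
  have z1 : a' * b = 0 := by nlinarith [mul_nonneg ha' hb, mul_nonneg hb' hd]
  have z2 : b' * d = 0 := by nlinarith [mul_nonneg ha' hb, mul_nonneg hb' hd]
  have z3 : c' * a = 0 := by nlinarith [mul_nonneg hc' ha, mul_nonneg hd' hc]
  have z4 : d' * c = 0 := by nlinarith [mul_nonneg hc' ha, mul_nonneg hd' hc]
  by_cases h0 : a' = 0
  · rw [h0, zero_mul, zero_add] at e1
    have hb0 : b' ≠ 0 := by rintro rfl; simp at e1
    have hc0 : c ≠ 0 := by rintro rfl; simp at e1
    have hd0 : d = 0 := (mul_eq_zero.1 z2).resolve_left hb0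
    rw [hd0, mul_zero, add_zero] at e4
    have hc'0 : c' ≠ 0 := by rintro rfl; simp at e4
    have hb0 : b ≠ 0 := by rintro rfl; simp at e4
    have ha0 : a = 0 := (mul_eq_zero.1 z3).resolve_left hc'0
    rw [ha0, zero_smul, zero_add] at h1
    rw [hd0, zero_smul, add_zero] at h2
    rw [hl'.eq_of_toPlane_eq_smul hm (hb.lt_of_ne' hb0) h1,
      hm'.eq_of_toPlane_eq_smul hl (hc.lt_of_ne' hc0) h2, ← Int.natAbs_neg]
    congr 1
    simp only [cross]
    ring
  · have hb0 : b = 0 := (mul_eq_zero.1 z1).resolve_left h0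
    rw [hb0, mul_zero, zero_add] at e4
    have hd'0 : d' ≠ 0 := by rintro rfl; simp at e4
    have hd0 : d ≠ 0 := by rintro rfl; simp at e4
    have hc0 : c = 0 := (mul_eq_zero.1 z4).resolve_left hd'0
    rw [hc0, mul_zero, add_zero] at e1
    have ha0 : a ≠ 0 := by rintro rfl; simp at e1
    rw [hb0, zero_smul, add_zero] at h1
    rw [hc0, zero_smul, zero_add] at h2
    rw [hl'.eq_of_toPlane_eq_smul hl (ha.lt_of_ne' ha0) h1,
      hm'.eq_of_toPlane_eq_smul hm (hd.lt_of_ne' hd0) h2]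

/-- A linear form on the side of a reflexive polygon cut out by an integral form `z` is bounded
by its values at the lattice points of the side. -/
lemma IsReflexivePolygon.dot_le_on_side {Q : Set Plane} (h : IsReflexivePolygon Q 0)
    {z : Fin 2 → ℤ} (hz : toPlane z ∈ dualPolygon Q 0) {c : Plane} {k : ℝ}
    (hk : ∀ a ∈ latticePoints Q, z ⬝ᵥ a = -1 → c ⬝ᵥ toPlane a ≤ k) {y : Plane} (hy : y ∈ Q)
    (hzy : toPlane z ⬝ᵥ y = -1) : c ⬝ᵥ y ≤ k := by
  -- Off the side the form `z` exceeds `-1` by at least one, so a large multiple of `z`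
  -- compensates for `c`.
  obtain ⟨N, hN⟩ := (h.finite_latticePoints.image fun a => c ⬝ᵥ toPlane a - k).bddAbove
  have hN' : ∀ a ∈ latticePoints Q, c ⬝ᵥ toPlane a - k ≤ max N 0 := fun a ha =>
    (hN ⟨a, ha, rfl⟩).trans (le_max_left _ _)
  set M := max N 0 with hM
  have hM0 : 0 ≤ M := le_max_right _ _
  have hy' := hy
  rw [h.eq_convexHull] at hy'
  have key := dot_ge_of_mem_convexHull (m := M • toPlane z - c) (c := -k - M) (by
    rintro _ ⟨a, ha, rfl⟩
    rw [sub_dotProduct, smul_dotProduct, smul_eq_mul, toPlane_dot]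
    have h1 := h.mem_dual_iff.1 hz a ha
    rw [toPlane_dot] at h1
    have h2 : -1 ≤ z ⬝ᵥ a := by exact_mod_cast h1
    rcases h2.eq_or_lt with h3 | h3
    · have := hk a ha h3.symm
      rw [← h3]
      push_cast
      linarith
    · have h4 : (0 : ℝ) ≤ ((z ⬝ᵥ a : ℤ) : ℝ) := by exact_mod_cast (by omega : 0 ≤ z ⬝ᵥ a)
      have := hN' a ha
      nlinarith [mul_nonneg hM0 h4]) hy'
  rw [sub_dotProduct, smul_dotProduct, smul_eq_mul, hzy] at key
  linarith

/-- At a vertex `v` of a centred convex set the dual cone is spanned by the dual side. -/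
lemma mem_dualConeAt_iff {K : Set Plane} (h0 : (0 : Plane) ∈ interior K) {v m : Plane} :
    m ∈ dualConeAt K v ↔ m = 0 ∨ ∃ r : ℝ, 0 < r ∧ ∃ y ∈ dualSide K 0 v, m = r • y := by
  constructor
  · intro hm
    by_cases hm0 : m = 0
    · exact Or.inl hm0
    right
    obtain ⟨x, hx, hlt⟩ := exists_dot_lt_of_mem_interior h0 hm0
    have h1 := hm x hx
    rw [dotProduct_sub] at h1
    rw [dotProduct_zero] at hlt
    have hr : 0 < -(m ⬝ᵥ v) := by linarith
    refine ⟨-(m ⬝ᵥ v), hr, (-(m ⬝ᵥ v))⁻¹ • m, ⟨?_, ?_⟩, ?_⟩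
    · rw [mem_dualPolygon_zero]
      intro x hx
      have := hm x hx
      rw [dotProduct_sub] at this
      rw [smul_dotProduct, smul_eq_mul, ← mul_le_mul_iff_right₀ hr, ← mul_assoc,
        mul_inv_cancel₀ hr.ne']
      linarith
    · rw [sub_zero, smul_dotProduct, smul_eq_mul, ← neg_inj, ← mul_neg, inv_mul_cancel₀ hr.ne',
        neg_neg]
    · rw [smul_smul, mul_inv_cancel₀ hr.ne', one_smul]
  · rintro (rfl | ⟨r, hr, y, ⟨hy, hyv⟩, rfl⟩)
    · intro x _
      simp
    · intro x hx
      rw [sub_zero] at hyv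
      have := mem_dualPolygon_zero.1 hy x hx
      rw [smul_dotProduct, dotProduct_sub, hyv, smul_eq_mul]
      exact mul_nonneg hr.le (by linarith)

/-- The weight at a vertex of a reflexive polygon: the dual side has lattice distance one from the
origin, so that the determinant of its end points is its lattice length. -/
lemma IsReflexivePolygon.exists_weight {K : Set Plane} (h : IsReflexivePolygon K 0) {v : Plane}
    (hv : v ∈ K.extremePoints ℝ) : ∃ w : ℕ, HasTropicalLength (dualSide K 0 v) (w : ℝ) ∧
      ∀ w', IsACone w' (dualConeAt K v) ↔ w' = w := by
  have hv' : v ∈ (dualPolygon (dualPolygon K 0) 0).extremePoints ℝ := by rwa [h.dual_dual]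
  have hQ := h.dual
  obtain ⟨z, rfl⟩ := hQ.exists_lattice_of_extreme hv'
  obtain ⟨l, hl, m, hm, hlm, hzl, hzm⟩ := hQ.exists_active_pair hv'
  set Q := dualPolygon K 0 with hQdef
  rw [toPlane_dot] at hzl hzm
  have hzl : z ⬝ᵥ l = -1 := by exact_mod_cast hzl
  have hzm : z ⬝ᵥ m = -1 := by exact_mod_cast hzm
  -- `u` is the primitive direction of the dual side.
  obtain ⟨u, hu⟩ : ∃ u, u = m - l := ⟨_, rfl⟩
  have hlu : cross l u = 1 := by
    rw [← hlm, hu]; simp only [cross, Pi.sub_apply]; ring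
  have hzu : z ⬝ᵥ u = 0 := by rw [hu, dotProduct_sub, hzl, hzm, sub_self]
  have hline : ∀ y : Plane, toPlane z ⬝ᵥ y = -1 →
      y = toPlane l + cross (toPlane l) y • toPlane u := by
    intro y hy
    have key := cross_smul_eq (toPlane l) (toPlane u) y
    rw [cross_toPlane, hlu, Int.cast_one, one_smul] at key
    have h1 : cross y (toPlane u) = 1 := by
      have := congrArg (fun x => toPlane z ⬝ᵥ x) key
      simp only [dotProduct_add, dotProduct_smul, hy, toPlane_dot, hzl, hzu, smul_eq_mul] at this
      push_cast at this
      linarith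
    rw [h1, one_smul] at key
    exact key
  have hlineZ : ∀ y : Fin 2 → ℤ, z ⬝ᵥ y = -1 → y = l + cross l y • u := by
    intro y hy
    apply toPlane_injective
    rw [hline (toPlane y) (by rw [toPlane_dot, hy]; norm_num), toPlane_add, cross_toPlane]
    congr 1
    ext i
    simp
  have hfin : {a ∈ latticePoints Q | z ⬝ᵥ a = -1}.Finite :=
    hQ.finite_latticePoints.subset fun _ ha => ha.1
  obtain ⟨a₀, ⟨ha₀, hza₀⟩, hmin⟩ := Set.exists_min_image _ (fun a => cross l a) hfin ⟨l, hl, hzl⟩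
  obtain ⟨a₁, ⟨ha₁, hza₁⟩, hmax⟩ := Set.exists_max_image _ (fun a => cross l a) hfin ⟨l, hl, hzl⟩
  have hll : cross l l = 0 := by simp only [cross]; ring
  have hk₀ : cross l a₀ ≤ 0 := hll ▸ hmin l ⟨hl, hzl⟩
  have hk₁ : 1 ≤ cross l a₁ := hlm ▸ hmax m ⟨hm, hzm⟩
  obtain ⟨w, hw⟩ : ∃ w : ℕ, (w : ℤ) = cross l a₁ - cross l a₀ :=
    ⟨(cross l a₁ - cross l a₀).toNat, Int.toNat_of_nonneg (by omega)⟩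
  have hw1 : 1 ≤ w := by omega
  have hwR : (0 : ℝ) < w := by exact_mod_cast hw1
  have e₀ := hlineZ a₀ hza₀
  have e₁ := hlineZ a₁ hza₁
  have ediff : a₀ - a₁ = (w : ℤ) • (-u) := by
    rw [hw]
    conv_lhs => rw [e₀, e₁]
    module
  have edet : cross a₀ a₁ = w := by
    have : ∀ s t : ℤ, cross (l + s • u) (l + t • u) = (t - s) * cross l u := by
      intro s t
      simp only [cross, Pi.add_apply, Pi.smul_apply, smul_eq_mul]
      ring
    rw [hw, e₀, e₁, this, hlu, mul_one, ← e₀, ← e₁]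
  have ediffR : toPlane a₁ = toPlane a₀ + (w : ℝ) • toPlane u := by
    have : a₁ = a₀ + (w : ℤ) • u := by
      rw [smul_neg] at ediff
      rw [eq_sub_of_add_eq' (sub_eq_iff_eq_add.1 ediff).symm]
      abel
    rw [this, toPlane_add]
    congr 1
    ext i
    simp
  have hprim : ∀ a : Fin 2 → ℤ, z ⬝ᵥ a = -1 → Primitive a := by
    intro a ha
    rw [dot_eq] at ha
    exact primitive_of_combination (a := -z 0) (b := -z 1) (by linarith)
  have hup : Primitive u :=
    primitive_of_combination (a := -l 1) (b := l 0) (by rw [← hlu, cross]; ring)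
  have hzQ : toPlane z ∈ dualPolygon Q 0 := hv'.1
  have hside : dualSide K 0 (toPlane z) =
      segment ℝ (toPlane a₀) (toPlane a₀ + (w : ℝ) • toPlane u) := by
    ext y
    simp only [dualSide, sub_zero, ← hQdef, mem_ofPred_eq]
    rw [segment_eq_image']
    have hrot : ∀ x : Plane, ![-(l 1 : ℝ), l 0] ⬝ᵥ x = cross (toPlane l) x := by
      intro x
      rw [dot_eq]
      simp only [cross, cons_val_zero, cons_val_one, toPlane_apply]
      ring
    constructor
    · rintro ⟨hy, hyz⟩
      rw [dotProduct_comm] at hyz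
      have hle := hQ.dot_le_on_side hzQ (c := ![-(l 1 : ℝ), l 0]) (k := (cross l a₁ : ℤ))
        (by
          intro a ha hza
          rw [hrot, cross_toPlane]
          exact_mod_cast hmax a ⟨ha, hza⟩) hy hyz
      have hge := hQ.dot_le_on_side hzQ (c := -![-(l 1 : ℝ), l 0]) (k := -(cross l a₀ : ℤ))
        (by
          intro a ha hza
          rw [neg_dotProduct, hrot, cross_toPlane]
          have := hmin a ⟨ha, hza⟩
          exact neg_le_neg (by exact_mod_cast this)) hy hyz
      rw [neg_dotProduct, hrot] at hge
      rw [hrot] at hle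
      have hwR' : (w : ℝ) = (cross l a₁ : ℤ) - (cross l a₀ : ℤ) := by exact_mod_cast hw
      refine ⟨(cross (toPlane l) y - (cross l a₀ : ℤ)) / w, ⟨div_nonneg (by linarith) hwR.le,
        (div_le_one hwR).2 (by linarith)⟩, ?_⟩
      simp only [add_sub_cancel_left, smul_smul]
      rw [div_mul_cancel₀ _ hwR.ne']
      have e₀R := hline (toPlane a₀) (by rw [toPlane_dot, hza₀]; norm_num)
      rw [cross_toPlane] at e₀R
      have ey := hline y hyz
      rw [e₀R]
      conv_rhs => rw [ey]
      module
    · rintro ⟨θ, ⟨hθ0, hθ1⟩, rfl⟩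
      have e : toPlane a₀ + θ • (toPlane a₀ + (w : ℝ) • toPlane u - toPlane a₀) =
          (1 - θ) • toPlane a₀ + θ • toPlane a₁ := by
        rw [ediffR]; module
      simp only [e]
      refine ⟨hQ.convex ha₀.2 ha₁.2 (by linarith) hθ0 (by ring), ?_⟩
      rw [add_dotProduct, smul_dotProduct, smul_dotProduct, toPlane_dot, toPlane_dot,
        dotProduct_comm a₀, dotProduct_comm a₁, hza₀, hza₁]
      simp only [Int.cast_neg, Int.cast_one, smul_eq_mul]
      ring
  have hcone : dualConeAt K (toPlane z) =
      {x | ∃ a b : ℝ, 0 ≤ a ∧ 0 ≤ b ∧ x = a • toPlane a₀ + b • toPlane a₁} := by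
    ext x
    rw [mem_dualConeAt_iff h.zero_mem_interior, hside, ← ediffR]
    constructor
    · rintro (rfl | ⟨r, hr, _, ⟨a, b, ha, hb, -, rfl⟩, rfl⟩)
      · exact ⟨0, 0, le_rfl, le_rfl, by simp⟩
      · exact ⟨r * a, r * b, mul_nonneg hr.le ha, mul_nonneg hr.le hb, by module⟩
    · rintro ⟨a, b, ha, hb, rfl⟩
      rcases (add_nonneg ha hb).eq_or_lt with h0 | hpos
      · left
        have ha0 : a = 0 := by linarith
        have hb0 : b = 0 := by linarith
        simp [ha0, hb0]
      · right
        refine ⟨a + b, hpos, _, ⟨a / (a + b), b / (a + b), by positivity, by positivity,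
          by rw [← add_div, div_self hpos.ne'], rfl⟩, ?_⟩
        rw [smul_add, smul_smul, smul_smul, mul_div_cancel₀ _ hpos.ne',
          mul_div_cancel₀ _ hpos.ne']
  refine ⟨w, ⟨hwR.le, toPlane a₀, u, hup, hside⟩, fun w' => ⟨?_, ?_⟩⟩
  · rintro ⟨hw', l', m', -, hl', hm', hdet, -, hC⟩
    rw [hcone] at hC
    have := natAbs_cross_eq_of_cone_eq (hprim a₀ hza₀) (hprim a₁ hza₁) hl' hm'
      (by rw [edet]; exact_mod_cast (by omega : w ≠ 0)) hC
    rw [edet, Int.natAbs_natCast] at this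
    exact hdet.symm.trans this
  · rintro rfl
    refine ⟨hw1, a₀, a₁, -u, hprim a₀ hza₀, hprim a₁ hza₁, ?_, ediff, hcone⟩
    have : a₀ 0 * a₁ 1 - a₀ 1 * a₁ 0 = w' := edet
    rw [this, Int.natAbs_natCast]

/-- A change of coordinates by `GL₂(ℤ)` preserves the type of the dual cone. -/
lemma IsACone.dualConeAt_linMap {K : Set Plane} {v : Plane} {w : ℕ} (g : GL (Fin 2) ℤ)
    (h : IsACone w (dualConeAt K v)) : IsACone w (dualConeAt (linMap g '' K) (linMap g v)) := by
  obtain ⟨hw, l, m, u, hl, hm, hd, hu, hC⟩ := h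
  have hprim : ∀ z, Primitive z → Primitive ((contragredient g).val *ᵥ z) := by
    intro z hz
    obtain ⟨x, y, hxy⟩ := Int.isCoprime_iff_gcd_eq_one.2 hz
    have e : (![x, y] ᵥ* ((contragredient g)⁻¹).val) ⬝ᵥ ((contragredient g).val *ᵥ z) = 1 := by
      rw [← dotProduct_mulVec, inv_mulVec_mulVec, dot_eq]
      exact hxy
    rw [dot_eq] at e
    exact primitive_of_combination e
  refine ⟨hw, (contragredient g).val *ᵥ l, (contragredient g).val *ᵥ m,
    (contragredient g).val *ᵥ u, hprim l hl, hprim m hm, ?_, ?_, ?_⟩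
  · have hdet : (contragredient g).val.det.natAbs = 1 :=
      Int.isUnit_iff_natAbs_eq.1 (Matrix.isUnits_det_units _)
    have e : ∀ A : Matrix (Fin 2) (Fin 2) ℤ, (A *ᵥ l) 0 * (A *ᵥ m) 1 - (A *ᵥ l) 1 * (A *ᵥ m) 0 =
        A.det * (l 0 * m 1 - l 1 * m 0) := by
      intro A
      simp only [mulVec, dot_eq, Matrix.det_fin_two]
      ring
    rw [e, Int.natAbs_mul, hdet, one_mul, hd]
  · rw [← mulVec_sub, hu, mulVec_smul]
  · ext x
    have key : ∀ y, linMap (contragredient g) y ∈ dualConeAt (linMap g '' K) (linMap g v) ↔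
        y ∈ dualConeAt K v := by
      intro y
      constructor
      · intro hy z hz
        have := hy _ ⟨z, hz, rfl⟩
        rwa [← map_sub, contragredient_dot_linMap] at this
      · rintro hy _ ⟨z, hz, rfl⟩
        rw [← map_sub, contragredient_dot_linMap]
        exact hy z hz
    rw [← linMap_linMap_inv (contragredient g) x, key, hC, mem_ofPred_eq, mem_ofPred_eq]
    simp only [← linMap_toPlane, ← map_smul, ← map_add]
    simp only [(linMap_injective (contragredient g)).eq_iff]

/-! ### Fronts that shrink homothetically -/

/-- The front `Φ(T - τ)` is the polygon `K`, scaled by `τ` around the point `p`, for all `τ` from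
`0` to `τ₀`. -/
structure ShrinksTo (Φ : Set Plane) (p : Plane) (T τ₀ : ℝ) (K : Set Plane) : Prop where
  pos : 0 < τ₀
  le : τ₀ ≤ T
  convex : Convex ℝ K
  isCompact : IsCompact K
  zero_mem_interior : (0 : Plane) ∈ interior K
  propagation_eq : ∀ τ, 0 ≤ τ → τ ≤ τ₀ → propagation Φ (T - τ) = (fun y => τ • y + p) '' K

lemma propagation_anti (Φ : Set Plane) {s t : ℝ} (h : s ≤ t) :
    propagation Φ t ⊆ propagation Φ s := fun x hx l c hc => by
  have : c + t ≤ toPlane l ⬝ᵥ x := hx l c hc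
  show c + s ≤ toPlane l ⬝ᵥ x
  linarith

lemma interior_image_smul_add (K : Set Plane) {τ : ℝ} (hτ : τ ≠ 0) (p : Plane) :
    interior ((fun y => τ • y + p) '' K) = (fun y => τ • y + p) '' interior K := by
  have := ((Homeomorph.smulOfNeZero τ hτ).trans (Homeomorph.addRight p)).image_interior K
  exact this.symm

lemma extremePoints_image_smul_add (K : Set Plane) {τ : ℝ} (hτ : τ ≠ 0) (p : Plane) :
    ((fun y => τ • y + p) '' K).extremePoints ℝ = (fun y => τ • y + p) '' K.extremePoints ℝ :=
  extremePoints_image (τ • LinearMap.id) (fun x y h => by simpa [hτ] using h) p K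

lemma dualConeAt_image_smul_add (K : Set Plane) {τ : ℝ} (hτ : 0 < τ) (p v : Plane) :
    dualConeAt ((fun y => τ • y + p) '' K) (τ • v + p) = dualConeAt K v := by
  ext m
  have key : ∀ y : Plane, m ⬝ᵥ (τ • y + p - (τ • v + p)) = τ * m ⬝ᵥ (y - v) := by
    intro y
    rw [add_sub_add_right_eq_sub, ← smul_sub, dotProduct_smul, smul_eq_mul]
  constructor
  · intro hm y hy
    have := hm _ ⟨y, hy, rfl⟩
    rw [key] at this
    exact (mul_nonneg_iff_of_pos_left hτ).1 this
  · rintro hm _ ⟨y, hy, rfl⟩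
    rw [key]
    exact mul_nonneg hτ.le (hm y hy)

lemma notMem_interior_of_mem_extremePoints {C : Set Plane} {x : Plane}
    (hx : x ∈ C.extremePoints ℝ) : x ∉ interior C := by
  intro hi
  have h1 := eventually_add_smul_mem_interior hi (fun _ => 1)
  have h2 := eventually_add_smul_mem_interior hi (-fun _ => 1)
  obtain ⟨e, ⟨he1, he2⟩, he⟩ := (((h1.and h2).filter_mono
    (nhdsWithin_le_nhds (s := Ioi 0))).and self_mem_nhdsWithin).exists
  have := hx.2 (interior_subset he1) (interior_subset he2)
    ⟨1 / 2, 1 / 2, by norm_num, by norm_num, by norm_num, by module⟩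
  have h3 := congrFun this 0
  simp only [Pi.add_apply, Pi.smul_apply, smul_eq_mul, mul_one] at h3
  linarith

/-- The rays from an interior point to distinct extreme points have nothing else in common. -/
lemma smul_extremePoints_injective {K : Set Plane} (hK : Convex ℝ K)
    (h0 : (0 : Plane) ∈ interior K) {v v' : Plane} (hv : v ∈ K.extremePoints ℝ)
    (hv' : v' ∈ K.extremePoints ℝ) {τ τ' : ℝ} (hτ : 0 < τ) (hτ' : 0 < τ')
    (h : τ • v = τ' • v') : τ = τ' ∧ v = v' := by
  have aux : ∀ {v v' : Plane} {τ τ' : ℝ}, v ∈ K.extremePoints ℝ → v' ∈ K.extremePoints ℝ →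
      0 < τ → 0 < τ' → τ • v = τ' • v' → ¬ τ' < τ := by
    intro v v' τ τ' hv hv' hτ hτ' h hlt
    apply notMem_interior_of_mem_extremePoints hv
    have : v = (τ' / τ) • v' := by
      rw [div_eq_inv_mul, mul_smul, ← h, smul_smul, inv_mul_cancel₀ hτ.ne', one_smul]
    rw [this]
    exact smul_mem_interior hK h0 hv'.1 (div_nonneg hτ'.le hτ.le) ((div_lt_one hτ).2 hlt)
  have he : τ = τ' := le_antisymm (not_lt.1 (aux hv hv' hτ hτ' h))
    (not_lt.1 (aux hv' hv hτ' hτ h.symm))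
  refine ⟨he, ?_⟩
  rw [← he] at h
  exact smul_right_injective _ hτ.ne' h

namespace ShrinksTo

variable {Φ : Set Plane} {p : Plane} {T τ₀ : ℝ} {K : Set Plane} (h : ShrinksTo Φ p T τ₀ K)
include h

lemma mono {τ₁ : ℝ} (h1 : 0 < τ₁) (h2 : τ₁ ≤ τ₀) : ShrinksTo Φ p T τ₁ K :=
  ⟨h1, h2.trans h.le, h.convex, h.isCompact, h.zero_mem_interior,
    fun τ ha hb => h.propagation_eq τ ha (hb.trans h2)⟩

lemma propagation_finalTime : propagation Φ T = {p} := by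
  have := h.propagation_eq 0 le_rfl h.pos.le
  rw [sub_zero] at this
  rw [this]
  simp only [zero_smul, zero_add]
  exact Set.Nonempty.image_const ⟨0, interior_subset h.zero_mem_interior⟩ p

lemma finalTime_eq : finalTime Φ = (T : EReal) := by
  apply IsGLB.sInf_eq
  apply IsLeast.isGLB
  refine ⟨⟨T, ⟨(h.pos.trans_le h.le).le, ?_⟩, rfl⟩, ?_⟩
  · rw [h.propagation_finalTime]
    exact interior_singleton p
  · rintro _ ⟨t, ⟨-, ht⟩, rfl⟩
    by_contra hlt
    have hlt' : t < T := by simpa using hlt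
    have hτ : 0 < min τ₀ (T - t) := lt_min h.pos (sub_pos.2 hlt')
    have hsub : propagation Φ (T - min τ₀ (T - t)) ⊆ propagation Φ t :=
      propagation_anti Φ (by have := min_le_right τ₀ (T - t); linarith)
    rw [h.propagation_eq _ hτ.le (min_le_left _ _)] at hsub
    have hp : p ∈ interior ((fun y => min τ₀ (T - t) • y + p) '' K) := by
      rw [interior_image_smul_add K hτ.ne']
      exact ⟨0, h.zero_mem_interior, by simp⟩
    have := interior_mono hsub hp
    rw [ht] at this
    exact this

lemma finalLocus_eq : finalLocus Φ = {p} := by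
  rw [← h.propagation_finalTime]
  ext x
  simp only [finalLocus, mem_ofPred_eq, h.finalTime_eq, EReal.coe_eq_coe_iff]
  simp

lemma isFrontVertex_iff {τ : ℝ} (hτ : 0 < τ) (hτ' : τ < τ₀) {x : Plane} :
    IsFrontVertex Φ (T - τ) x ↔ ∃ v ∈ K.extremePoints ℝ, x = τ • v + p := by
  have hle := h.le
  rw [IsFrontVertex, h.finalTime_eq, EReal.coe_lt_coe_iff, h.propagation_eq τ hτ.le hτ'.le,
    extremePoints_image_smul_add K hτ.ne']
  constructor
  · rintro ⟨-, -, v, hv, rfl⟩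
    exact ⟨v, hv, rfl⟩
  · rintro ⟨v, hv, rfl⟩
    exact ⟨by linarith, by linarith, v, hv, rfl⟩

/-- The vertices of all fronts outside of `p + τ₀ K` stay outside of its interior. -/
lemma lt_of_isFrontVertex {t : ℝ} {x : Plane} (hx : x ∈ (fun y => τ₀ • y + p) '' interior K)
    (hf : IsFrontVertex Φ t x) : T - τ₀ < t := by
  by_contra hle
  apply notMem_interior_of_mem_extremePoints hf.2.2
  refine interior_mono (propagation_anti Φ (not_lt.1 hle)) ?_
  rwa [h.propagation_eq τ₀ h.pos.le le_rfl, interior_image_smul_add K h.pos.ne']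

lemma isFrontVertex_iff_of_mem {t : ℝ} {x : Plane}
    (hx : x ∈ (fun y => τ₀ • y + p) '' interior K) :
    IsFrontVertex Φ t x ↔ ∃ τ, 0 < τ ∧ τ < τ₀ ∧ t = T - τ ∧
      ∃ v ∈ K.extremePoints ℝ, x = τ • v + p := by
  constructor
  · intro hf
    have h1 := h.lt_of_isFrontVertex hx hf
    have h2 := hf.2.1
    rw [h.finalTime_eq, EReal.coe_lt_coe_iff] at h2
    have e : t = T - (T - t) := by ring
    refine ⟨T - t, by linarith, by linarith, e, ?_⟩
    rw [e] at hf
    exact (h.isFrontVertex_iff (by linarith) (by linarith)).1 hf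
  · rintro ⟨τ, h1, h2, rfl, hv⟩
    exact (h.isFrontVertex_iff h1 h2).2 hv

lemma mem_caustic_iff {x : Plane} (hx : x ∈ (fun y => τ₀ • y + p) '' interior K) :
    x ∈ caustic Φ ↔ x = p ∨ ∃ τ, 0 < τ ∧ τ < τ₀ ∧ ∃ v ∈ K.extremePoints ℝ, x = τ • v + p := by
  rw [caustic, h.finalLocus_eq, mem_union, mem_singleton_iff, or_comm]
  refine or_congr_right ?_
  simp only [mem_ofPred_eq, h.isFrontVertex_iff_of_mem hx]
  constructor
  · rintro ⟨t, τ, h1, h2, -, hv⟩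
    exact ⟨τ, h1, h2, hv⟩
  · rintro ⟨τ, h1, h2, hv⟩
    exact ⟨T - τ, τ, h1, h2, rfl, hv⟩

lemma smul_add_mem {v : Plane} (hv : v ∈ K.extremePoints ℝ) {τ : ℝ} (hτ : 0 ≤ τ) (hτ' : τ < τ₀) :
    τ • v + p ∈ (fun y => τ₀ • y + p) '' interior K := by
  refine ⟨(τ / τ₀) • v, smul_mem_interior h.convex h.zero_mem_interior hv.1
    (div_nonneg hτ h.pos.le) ((div_lt_one h.pos).2 hτ'), ?_⟩
  simp only [smul_smul]
  rw [mul_div_cancel₀ _ h.pos.ne']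

lemma ne_zero_of_mem_extremePoints {v : Plane} (hv : v ∈ K.extremePoints ℝ) : v ≠ 0 := by
  rintro rfl
  exact notMem_interior_of_mem_extremePoints hv h.zero_mem_interior

lemma mem_image_interior : p ∈ (fun y => τ₀ • y + p) '' interior K :=
  ⟨0, h.zero_mem_interior, by simp⟩

lemma hasCausticWeight_iff {v : Plane} (hv : v ∈ K.extremePoints ℝ) {τ : ℝ} (hτ : 0 < τ)
    (hτ' : τ < τ₀) (w : ℕ) :
    HasCausticWeight Φ (τ • v + p) w ↔ IsACone w (dualConeAt K v) := by
  have hne : τ • v + p ∉ finalLocus Φ := by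
    rw [h.finalLocus_eq, mem_singleton_iff, add_eq_right]
    exact smul_ne_zero hτ.ne' (h.ne_zero_of_mem_extremePoints hv)
  rw [HasCausticWeight, or_iff_left fun hc => hne hc.1]
  have hcone : ∀ σ, 0 < σ → σ < τ₀ → dualConeAt (propagation Φ (T - σ)) (σ • v + p) =
      dualConeAt K v := by
    intro σ hσ hσ'
    rw [h.propagation_eq σ hσ.le hσ'.le, dualConeAt_image_smul_add K hσ]
  constructor
  · rintro ⟨t, hf, hw⟩
    obtain ⟨σ, h1, h2, rfl, v', hv', he⟩ :=
      (h.isFrontVertex_iff_of_mem (h.smul_add_mem hv hτ.le hτ')).1 hf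
    obtain ⟨rfl, rfl⟩ := smul_extremePoints_injective h.convex h.zero_mem_interior hv hv' hτ h1
      (add_right_cancel he)
    rwa [hcone τ h1 h2] at hw
  · intro hw
    exact ⟨T - τ, (h.isFrontVertex_iff hτ hτ').2 ⟨v, hv, rfl⟩, by rwa [hcone τ hτ hτ']⟩

lemma hasCausticWeight_center_iff (w : ℕ) : HasCausticWeight Φ p w ↔ w = 2 := by
  rw [HasCausticWeight, h.finalLocus_eq, or_iff_right]
  · simp
  · rintro ⟨t, hf, -⟩
    obtain ⟨τ, h1, -, -, v, hv, he⟩ := (h.isFrontVertex_iff_of_mem h.mem_image_interior).1 hf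
    have : τ • v = 0 := by simpa using he.symm
    exact smul_ne_zero h1.ne' (h.ne_zero_of_mem_extremePoints hv) this

lemma isGraphVertex : IsGraphVertex (caustic Φ) p := by
  refine ⟨(h.mem_caustic_iff h.mem_image_interior).2 (Or.inl rfl), ?_⟩
  rintro ⟨d, U, hd, hU, hpU, hK⟩
  -- If the caustic were straight at `p`, then all extreme points would lie on the line `n · x = 0`.
  have hext : ∀ v ∈ K.extremePoints ℝ, 0 ≤ ![-d 1, d 0] ⬝ᵥ v := by
    intro v hv
    have hc : ContinuousAt (fun τ : ℝ => τ • v + p) 0 := by fun_prop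
    have hev : ∀ᶠ τ : ℝ in 𝓝 0, τ • v + p ∈ U := hc.eventually (by simpa using hU.mem_nhds hpU)
    obtain ⟨τ, ⟨h1, h2⟩, h3⟩ := (((hev.and (gt_mem_nhds h.pos)).filter_mono
      (nhdsWithin_le_nhds (s := Ioi 0))).and self_mem_nhdsWithin).exists
    have hmem : τ • v + p ∈ caustic Φ ∩ U :=
      ⟨(h.mem_caustic_iff (h.smul_add_mem hv h3.le h2)).2 (Or.inr ⟨τ, h3, h2, v, hv, rfl⟩), h1⟩
    rw [hK] at hmem
    obtain ⟨⟨s, hs⟩, -⟩ := hmem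
    rw [add_comm, add_left_cancel_iff] at hs
    have e0 : τ * v 0 = s * d 0 := congrFun hs 0
    have e1 : τ * v 1 = s * d 1 := congrFun hs 1
    rw [dot_eq]
    simp only [cons_val_zero, cons_val_one]
    have : τ * (-d 1 * v 0 + d 0 * v 1) = 0 := by linear_combination d 0 * e1 - d 1 * e0
    exact ((mul_eq_zero.1 this).resolve_left h3.ne').ge
  obtain ⟨x, hx, hlt⟩ := exists_dot_lt_of_mem_interior h.zero_mem_interior
    (m := ![-d 1, d 0]) (by
      intro h0
      apply hd
      have h1 := congrFun h0 0
      have h2 := congrFun h0 1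
      simp at h1 h2
      ext i; fin_cases i <;> simp [h1, h2])
  rw [← closure_convexHull_extremePoints h.isCompact h.convex] at hx
  have := closure_minimal (convexHull_min (t := {x : Plane | 0 ≤ ![-d 1, d 0] ⬝ᵥ x}) hext
    (convex_dot_ge _ 0)) (isClosed_dot_ge _ 0) hx
  rw [dotProduct_zero] at hlt
  exact absurd hlt (not_lt.2 this)

end ShrinksTo

/-- The caustics of two sets whose fronts finally are homothetic to polygons related by
`GL₂(ℤ)` are locally isomorphic. -/
lemma ShrinksTo.causticsLocallyIsomorphic {Φ Ψ K : Set Plane} {p q : Plane} {T T' τ₀ τ₁ : ℝ}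
    (g : GL (Fin 2) ℤ) (h : ShrinksTo Φ p T τ₀ K) (h' : ShrinksTo Ψ q T' τ₁ (linMap g '' K)) :
    CausticsLocallyIsomorphic Φ p Ψ q := by
  wlog hτ : τ₀ = τ₁ generalizing τ₀ τ₁
  · have hpos : 0 < min τ₀ τ₁ := lt_min h.pos h'.pos
    exact this (h.mono hpos (min_le_left _ _)) (h'.mono hpos (min_le_right _ _)) rfl
  subst hτ
  set f : Plane → Plane := fun x => linMap g x + (q - linMap g p) with hf
  have hfs : ∀ (τ : ℝ) (y : Plane), f (τ • y + p) = τ • linMap g y + q := by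
    intro τ y
    simp only [hf, map_add, map_smul]
    abel
  have hfp : f p = q := by simp [hf]
  have hinj : Function.Injective f := (tropicalHomeomorph g (q - linMap g p)).injective
  set U := (fun y => τ₀ • y + p) '' interior K with hUdef
  have hint : interior (linMap g '' K) = linMap g '' interior K := by
    have := (tropicalHomeomorph g 0).image_interior K
    simpa [coe_tropicalHomeomorph] using this.symm
  have hext : (linMap g '' K).extremePoints ℝ = linMap g '' K.extremePoints ℝ := by
    simpa using extremePoints_image (linMap g) (linMap_injective g) 0 K
  have hfU : f '' U = (fun y => τ₀ • y + q) '' interior (linMap g '' K) := by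
    rw [hint, hUdef, image_image, image_image]
    simp only [hfs]
  have hcaustic : ∀ x ∈ U, x ∈ caustic Φ ↔ f x ∈ caustic Ψ := by
    intro x hx
    rw [h.mem_caustic_iff hx, h'.mem_caustic_iff (hfU ▸ mem_image_of_mem f hx), hext]
    refine or_congr ?_ ?_
    · rw [← hfp, hinj.eq_iff]
    · simp only [exists_mem_image, ← hfs, hinj.eq_iff]
  refine ⟨f, U, ⟨g, q - linMap g p, fun x => rfl⟩, hfp, ?_, h.mem_image_interior, ?_, ?_⟩
  · rw [hUdef, ← interior_image_smul_add K h.pos.ne']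
    exact isOpen_interior
  · ext y
    constructor
    · rintro ⟨x, ⟨hx, hxU⟩, rfl⟩
      exact ⟨(hcaustic x hxU).1 hx, x, hxU, rfl⟩
    · rintro ⟨hy, x, hxU, rfl⟩
      exact ⟨x, ⟨(hcaustic x hxU).2 hy, hxU⟩, rfl⟩
  · rintro x ⟨hx, hxU⟩ w
    rcases (h.mem_caustic_iff hxU).1 hx with rfl | ⟨τ, h1, h2, v, hv, rfl⟩
    · rw [hfp, h.hasCausticWeight_center_iff, h'.hasCausticWeight_center_iff]
    · rw [hfs, h.hasCausticWeight_iff hv h1 h2,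
        h'.hasCausticWeight_iff (hext ▸ mem_image_of_mem _ hv) h1 h2]
      refine ⟨IsACone.dualConeAt_linMap g, fun hw => ?_⟩
      have := hw.dualConeAt_linMap g⁻¹
      rw [image_image] at this
      simpa only [linMap_inv_linMap, image_id'] using this

/-! ### Support half-planes -/

lemma Primitive.ne_zero {l : Fin 2 → ℤ} (hl : Primitive l) : l ≠ 0 := by
  rintro rfl
  simp [Primitive] at hl

lemma Primitive.toPlane_ne_zero {l : Fin 2 → ℤ} (hl : Primitive l) : toPlane l ≠ 0 := by
  simpa using hl.ne_zero

/-- Every nonzero lattice vector is a positive multiple of a primitive one. -/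
lemma exists_primitive {z : Fin 2 → ℤ} (hz : z ≠ 0) :
    ∃ (n : ℕ) (l : Fin 2 → ℤ), 1 ≤ n ∧ Primitive l ∧ toPlane z = (n : ℝ) • toPlane l := by
  have hpos : 0 < Int.gcd (z 0) (z 1) := by
    rw [Int.gcd_pos_iff]
    by_contra hc
    push Not at hc
    apply hz
    ext i; fin_cases i
    · exact hc.1
    · exact hc.2
  obtain ⟨a, b, hab, ha, hb⟩ := Int.exists_gcd_one hpos
  refine ⟨Int.gcd (z 0) (z 1), ![a, b], hpos, hab, ?_⟩
  ext i
  fin_cases i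
  · simp only [Fin.zero_eta, toPlane_apply, Pi.smul_apply, smul_eq_mul, cons_val_zero]
    rw [mul_comm]; exact_mod_cast ha
  · simp only [Fin.mk_one, toPlane_apply, Pi.smul_apply, smul_eq_mul, cons_val_one]
    rw [mul_comm]; exact_mod_cast hb

lemma IsSupport.exists_mem {Φ : Set Plane} (hΦ : IsClosed Φ) {l : Fin 2 → ℤ} {c : ℝ}
    (h : IsSupport Φ l c) : ∃ q ∈ Φ, toPlane l ⬝ᵥ q = c := by
  obtain ⟨q, hq, hc⟩ := h.2.2
  exact ⟨q, hΦ.frontier_subset hq, hc⟩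

lemma isSupport_of_isLeast {Φ : Set Plane} {l : Fin 2 → ℤ} (hl : Primitive l) {q : Plane}
    (hq : q ∈ Φ) (hmin : ∀ x ∈ Φ, toPlane l ⬝ᵥ q ≤ toPlane l ⬝ᵥ x) :
    IsSupport Φ l (toPlane l ⬝ᵥ q) := by
  refine ⟨hl, hmin, q, ⟨subset_closure hq, fun hi => ?_⟩, rfl⟩
  obtain ⟨x, hx, hlt⟩ := exists_dot_lt_of_mem_interior hi hl.toPlane_ne_zero
  exact absurd (hmin x hx) (not_le.2 hlt)

lemma exists_isSupport {Φ : Set Plane} (hΦ : IsCompact Φ) (hne : Φ.Nonempty) {l : Fin 2 → ℤ}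
    (hl : Primitive l) : ∃ c, IsSupport Φ l c := by
  obtain ⟨q, hq, hmin⟩ := hΦ.exists_isMinOn hne (continuous_dot (toPlane l)).continuousOn
  exact ⟨_, isSupport_of_isLeast hl hq hmin⟩

lemma IsSupport.unique {Φ : Set Plane} (hΦ : IsClosed Φ) {l : Fin 2 → ℤ} {c c' : ℝ}
    (h : IsSupport Φ l c) (h' : IsSupport Φ l c') : c = c' := by
  obtain ⟨q, hq, rfl⟩ := h.exists_mem hΦ
  obtain ⟨q', hq', rfl⟩ := h'.exists_mem hΦ
  exact le_antisymm (h.2.1 hq') (h'.2.1 hq)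

/-! ### The caustic of a reflexive polygon -/

section ReflexiveCaustic

variable {P : Set Plane} {o : Fin 2 → ℤ} (h : IsReflexivePolygon P o)

lemma image_sub_add (P : Set Plane) (q : Plane) :
    (fun y => (1 : ℝ) • y + q) '' ((fun x => x - q) '' P) = P := by
  rw [image_image]
  simp

lemma extremePoints_eq_image_sub (P : Set Plane) (q : Plane) : P.extremePoints ℝ =
    (fun y => y + q) '' ((fun x => x - q) '' P).extremePoints ℝ := by
  conv_lhs => rw [← image_sub_add P q, extremePoints_image_smul_add _ one_ne_zero]
  simp only [one_smul]

include h

/-- The translate of a reflexive polygon that has its interior lattice point at the origin. -/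
lemma IsReflexivePolygon.center : IsReflexivePolygon ((fun x => x - toPlane o) '' P) 0 := by
  obtain ⟨⟨S, hS⟩, hint⟩ := h
  constructor
  · refine ⟨S.image fun z => z - o, ?_⟩
    have e := (AffineMap.id ℝ Plane - AffineMap.const ℝ Plane (toPlane o)).image_convexHull
      (toPlane '' (S : Set (Fin 2 → ℤ)))
    rw [← hS] at e
    rw [Finset.coe_image, image_image]
    refine Eq.trans e ?_
    rw [image_image]
    congr 1
    refine image_congr fun z _ => ?_
    rw [sub_eq_add_neg z, toPlane_add, toPlane_neg, ← sub_eq_add_neg]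
    rfl
  · have hi := (Homeomorph.subRight (toPlane o)).image_interior P
    have hi' : interior ((fun x => x - toPlane o) '' P) =
        (fun x => x - toPlane o) '' interior P := hi.symm
    ext z
    rw [hi', mem_ofPred_eq, mem_singleton_iff]
    have hz : z + o ∈ {z : Fin 2 → ℤ | toPlane z ∈ interior P} ↔ z + o = o := by
      rw [hint, mem_singleton_iff]
    rw [add_eq_right, mem_ofPred_eq, toPlane_add] at hz
    rw [← hz]
    constructor
    · rintro ⟨x, hx, hxz⟩
      simp only at hxz
      rwa [← hxz, sub_add_cancel]
    · exact fun hz' => ⟨_, hz', by simp⟩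

/-- The fronts of a reflexive polygon are its homothetic images: all its sides have lattice
distance one from the interior lattice point, and no other rational support line is closer. -/
lemma IsReflexivePolygon.shrinksTo :
    ShrinksTo P (toPlane o) 1 1 ((fun x => x - toPlane o) '' P) := by
  have hK := h.center
  obtain ⟨K, hKdef⟩ : ∃ K, K = (fun x => x - toPlane o) '' P := ⟨_, rfl⟩
  rw [← hKdef] at hK ⊢
  have hmemP : ∀ y ∈ K, y + toPlane o ∈ P := by
    rw [hKdef]
    rintro _ ⟨x, hx, rfl⟩
    simpa using hx
  have hmemK : ∀ x ∈ P, x - toPlane o ∈ K := fun x hx => hKdef ▸ mem_image_of_mem _ hx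
  have hclosed : IsClosed P := by
    have := (hK.isCompact.image (continuous_id.add (continuous_const (y := toPlane o)))).isClosed
    convert this using 1
    rw [hKdef, image_image]
    simp
  have hdeep : ∀ l : Fin 2 → ℤ, l ≠ 0 → ∃ a ∈ latticePoints K, l ⬝ᵥ a ≤ -1 := by
    intro l hl
    obtain ⟨a, ha, hlt⟩ := hK.exists_dot_neg (m := toPlane l) (by simpa using hl)
    rw [toPlane_dot] at hlt
    have : l ⬝ᵥ a < 0 := by exact_mod_cast hlt
    exact ⟨a, ha, by omega⟩
  refine ⟨one_pos, le_rfl, hK.convex, hK.isCompact, hK.zero_mem_interior, fun τ h0 h1 => ?_⟩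
  apply subset_antisymm
  · intro x hx
    have hx' : ∀ l ∈ latticePoints (dualPolygon K 0), -τ ≤ (x - toPlane o) ⬝ᵥ toPlane l := by
      intro l hl
      obtain ⟨a, ha, hla⟩ := hdeep l hl.1
      have hge := mem_dualPolygon_zero.1 hl.2
      have hge' := hge _ ha.2
      rw [toPlane_dot] at hge'
      have hla' : l ⬝ᵥ a = -1 := le_antisymm hla (by exact_mod_cast hge')
      have hlp : Primitive l := by
        rw [dot_eq] at hla'
        exact primitive_of_combination (a := -a 0) (b := -a 1) (by linarith)
      have hval : toPlane l ⬝ᵥ (toPlane a + toPlane o) = toPlane l ⬝ᵥ toPlane o - 1 := by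
        rw [dotProduct_add, toPlane_dot l a, hla']
        push_cast
        ring
      have hsup := isSupport_of_isLeast hlp (hmemP _ ha.2) (by
        intro y hy
        have := hge _ (hmemK y hy)
        rw [dotProduct_sub] at this
        rw [hval]
        linarith)
      have hfin : toPlane l ⬝ᵥ (toPlane a + toPlane o) + (1 - τ) ≤ toPlane l ⬝ᵥ x :=
        hx _ _ hsup
      rw [hval] at hfin
      rw [dotProduct_comm, dotProduct_sub]
      linarith
    rcases h0.eq_or_lt with rfl | hpos
    · refine ⟨0, interior_subset hK.zero_mem_interior, ?_⟩
      by_contra hne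
      obtain ⟨l, hl, hlt⟩ := hK.dual.exists_dot_neg (m := x - toPlane o) (by
        intro hc
        apply hne
        rw [sub_eq_zero.1 hc]
        simp)
      have := hx' l hl
      linarith
    · refine ⟨τ⁻¹ • (x - toPlane o), ?_, ?_⟩
      · rw [← hK.dual_dual, hK.dual.mem_dual_iff]
        intro l hl
        rw [smul_dotProduct, smul_eq_mul, ← mul_le_mul_iff_right₀ hpos, ← mul_assoc,
          mul_inv_cancel₀ hpos.ne']
        have := hx' l hl
        linarith
      · simp only [smul_smul, mul_inv_cancel₀ hpos.ne', one_smul, sub_add_cancel]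
  · rintro _ ⟨y, hy, rfl⟩ l c hc
    obtain ⟨q, hq, rfl⟩ := hc.exists_mem hclosed
    obtain ⟨a, ha, hla⟩ := hdeep l hc.1.ne_zero
    have h2 : toPlane l ⬝ᵥ q ≤ toPlane l ⬝ᵥ (toPlane a + toPlane o) := hc.2.1 (hmemP _ ha.2)
    have h3 : toPlane l ⬝ᵥ q ≤ toPlane l ⬝ᵥ (y + toPlane o) := hc.2.1 (hmemP _ hy)
    have h4 : ((l ⬝ᵥ a : ℤ) : ℝ) ≤ -1 := by exact_mod_cast hla
    rw [dotProduct_add, toPlane_dot l a] at h2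
    rw [dotProduct_add] at h3
    show toPlane l ⬝ᵥ q + (1 - τ) ≤ toPlane l ⬝ᵥ (τ • y + toPlane o)
    rw [dotProduct_add, dotProduct_smul, smul_eq_mul]
    nlinarith [mul_le_mul_of_nonneg_left h3 h0,
      mul_le_mul_of_nonneg_left (h2.trans (add_le_add_left h4 _)) (sub_nonneg.2 h1)]

lemma IsReflexivePolygon.caustic_eq :
    caustic P = ⋃ v ∈ P.extremePoints ℝ, segment ℝ (toPlane o) v \ {v} := by
  have hs := h.shrinksTo
  have hK := h.center
  rw [extremePoints_eq_image_sub P (toPlane o)]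
  obtain ⟨K, hKdef⟩ : ∃ K, K = (fun x => x - toPlane o) '' P := ⟨_, rfl⟩
  rw [← hKdef] at hK hs ⊢
  have hseg : ∀ v ∈ K.extremePoints ℝ, ∀ x : Plane,
      x ∈ segment ℝ (toPlane o) (v + toPlane o) \ {v + toPlane o} ↔
        ∃ τ : ℝ, 0 ≤ τ ∧ τ < 1 ∧ x = τ • v + toPlane o := by
    intro v hv x
    have hv0 := hs.ne_zero_of_mem_extremePoints hv
    rw [segment_eq_image']
    constructor
    · rintro ⟨⟨τ, ⟨h0, h1⟩, rfl⟩, hne⟩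
      refine ⟨τ, h0, lt_of_le_of_ne h1 ?_, by simp [add_comm]⟩
      rintro rfl
      simp [add_comm] at hne
    · rintro ⟨τ, h0, h1, rfl⟩
      refine ⟨⟨τ, ⟨h0, h1.le⟩, by simp [add_comm]⟩, ?_⟩
      rw [mem_singleton_iff, add_left_inj]
      intro he
      have : (τ - 1) • v = 0 := by rw [sub_smul, he, one_smul, sub_self]
      rcases smul_eq_zero.1 this with h2 | h2
      · linarith
      · exact hv0 h2
  ext x
  simp only [mem_iUnion, exists_prop, exists_mem_image]
  constructor
  · rintro (⟨t, ht⟩ | hx)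
    · have h1 := ht.1
      have h2 := ht.2.1
      rw [hs.finalTime_eq, EReal.coe_lt_coe_iff] at h2
      have e : t = 1 - (1 - t) := by ring
      rw [e, hs.isFrontVertex_iff (by linarith) (by linarith)] at ht
      obtain ⟨v, hv, rfl⟩ := ht
      exact ⟨v, hv, (hseg v hv _).2 ⟨1 - t, by linarith, by linarith, rfl⟩⟩
    · rw [hs.finalLocus_eq, mem_singleton_iff] at hx
      obtain ⟨v, hv⟩ := hK.isCompact.extremePoints_nonempty
        ⟨0, interior_subset hK.zero_mem_interior⟩
      exact ⟨v, hv, (hseg v hv _).2 ⟨0, le_rfl, one_pos, by simp [hx]⟩⟩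
  · rintro ⟨v, hv, hx⟩
    obtain ⟨τ, h0, h1, rfl⟩ := (hseg v hv x).1 hx
    refine (hs.mem_caustic_iff (hs.smul_add_mem hv h0 h1)).2 ?_
    rcases h0.eq_or_lt with rfl | hpos
    · left; simp
    · exact Or.inr ⟨τ, hpos, h1, v, hv, rfl⟩

lemma IsReflexivePolygon.exists_caustic_weight {v : Plane} (hv : v ∈ P.extremePoints ℝ) :
    ∃ w : ℕ, HasTropicalLength (dualSide P (toPlane o) v) (w : ℝ) ∧
      ∀ x ∈ openSegment ℝ (toPlane o) v, ∀ w' : ℕ, HasCausticWeight P x w' ↔ w' = w := by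
  rw [extremePoints_eq_image_sub P (toPlane o)] at hv
  obtain ⟨e, he, rfl⟩ := hv
  obtain ⟨w, hlen, hw⟩ := h.center.exists_weight he
  refine ⟨w, ?_, ?_⟩
  · convert hlen using 1
    simp only [dualSide, dualPolygon, add_sub_cancel_right, sub_zero, forall_mem_image]
  · intro x hx w'
    rw [openSegment_eq_image'] at hx
    obtain ⟨τ, ⟨h0, h1⟩, rfl⟩ := hx
    simp only [add_sub_cancel_right]
    rw [add_comm, h.shrinksTo.hasCausticWeight_iff he h0 h1, hw]

end ReflexiveCaustic

/-! ### The last stage of the propagation -/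

/-- The sum of the absolute values of the coordinates of a lattice vector. -/
def sumAbs (l : Fin 2 → ℤ) : ℝ := |(l 0 : ℝ)| + |(l 1 : ℝ)|

/-- `sumAbs` is the operator norm with respect to the maximum norm of the plane. -/
lemma abs_dot_le (l : Fin 2 → ℤ) (x : Plane) : |toPlane l ⬝ᵥ x| ≤ sumAbs l * ‖x‖ := by
  rw [dot_eq, sumAbs, add_mul]
  refine (abs_add_le _ _).trans ?_
  rw [abs_mul, abs_mul]
  have h0 := norm_le_pi_norm x 0
  have h1 := norm_le_pi_norm x 1
  rw [Real.norm_eq_abs] at h0 h1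
  exact add_le_add (mul_le_mul_of_nonneg_left h0 (abs_nonneg _))
    (mul_le_mul_of_nonneg_left h1 (abs_nonneg _))

lemma sumAbs_nonneg (l : Fin 2 → ℤ) : 0 ≤ sumAbs l := by
  unfold sumAbs; positivity

lemma one_le_sumAbs {l : Fin 2 → ℤ} (hl : l ≠ 0) : 1 ≤ sumAbs l := by
  by_contra hc
  apply hl
  have h : |l 0| + |l 1| < 1 := by
    rw [not_le, sumAbs] at hc
    exact_mod_cast hc
  have h0 := abs_nonneg (l 0)
  have h1 := abs_nonneg (l 1)
  have e0 : l 0 = 0 := abs_eq_zero.1 (by omega)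
  have e1 : l 1 = 0 := abs_eq_zero.1 (by omega)
  ext i; fin_cases i
  · exact e0
  · exact e1

lemma finite_sumAbs_le (r : ℝ) : {l : Fin 2 → ℤ | sumAbs l ≤ r}.Finite := by
  refine (finite_lattice_of_isBounded (Metric.isBounded_closedBall (x := (0 : Plane))
    (r := r))).subset fun l hl => ?_
  rw [mem_ofPred_eq, sumAbs] at hl
  rw [mem_ofPred_eq, mem_closedBall_zero_iff]
  have h0 := abs_nonneg (l 0 : ℝ)
  have h1 := abs_nonneg (l 1 : ℝ)
  refine (pi_norm_le_iff_of_nonneg (by linarith)).2 fun i => ?_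
  rw [Real.norm_eq_abs]
  fin_cases i
  · show |(l 0 : ℝ)| ≤ r
    linarith
  · show |(l 1 : ℝ)| ≤ r
    linarith

lemma exists_dot_eq_sumAbs (l : Fin 2 → ℤ) : ∃ s : Plane, ‖s‖ ≤ 1 ∧ toPlane l ⬝ᵥ s = sumAbs l := by
  refine ⟨fun i => SignType.sign (l i : ℝ), ?_, ?_⟩
  · refine (pi_norm_le_iff_of_nonneg zero_le_one).2 fun i => ?_
    rcases lt_trichotomy (l i : ℝ) 0 with h | h | h <;> simp [h]
  · rw [dot_eq, sumAbs]
    simp only [toPlane_apply, mul_comm _ ((SignType.sign _ : SignType) : ℝ), sign_mul_self]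

/-- A set that contains the ball of radius `r` around `q` reaches to distance at least `r`,
measured by a linear form, below `q`. -/
lemma IsSupport.le_of_ball {Φ : Set Plane} {l : Fin 2 → ℤ} {c : ℝ} (h : IsSupport Φ l c)
    {q : Plane} {r : ℝ} (hr : 0 ≤ r) (hball : Metric.closedBall q r ⊆ Φ) :
    c ≤ toPlane l ⬝ᵥ q - r * sumAbs l := by
  obtain ⟨s, hs, hls⟩ := exists_dot_eq_sumAbs l
  have hmem : q - r • s ∈ Φ := by
    apply hball
    rw [mem_closedBall_iff_norm, sub_sub_cancel_left, norm_neg, norm_smul, Real.norm_eq_abs,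
      abs_of_nonneg hr]
    exact mul_le_of_le_one_right hr hs
  have : c ≤ toPlane l ⬝ᵥ (q - r • s) := h.2.1 hmem
  rwa [dotProduct_sub, dotProduct_smul, hls, smul_eq_mul] at this

lemma finalTime_pos {Φ : Set Plane} (hΦ : (interior Φ).Nonempty) {T : ℝ}
    (hT : finalTime Φ = (T : EReal)) : 0 < T := by
  obtain ⟨q, hq⟩ := hΦ
  obtain ⟨r, hr, hball⟩ := Metric.mem_nhds_iff.1 (mem_interior_iff_mem_nhds.1 hq)
  -- The concentric ball of one third of the radius lies in the front at time `r / 3`.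
  have hsub : Metric.ball q (r / 3) ⊆ propagation Φ (r / 3) := by
    intro x hx l c hc
    have h1 := hc.le_of_ball (q := x) (r := r / 3) (by linarith) (by
      intro y hy
      apply hball
      rw [Metric.mem_closedBall] at hy
      rw [Metric.mem_ball] at hx ⊢
      have := dist_triangle y x q
      linarith)
    have h2 := one_le_sumAbs hc.1.ne_zero
    show c + r / 3 ≤ toPlane l ⬝ᵥ x
    nlinarith
  have hle : ((r / 3 : ℝ) : EReal) ≤ finalTime Φ := by
    apply le_sInf
    rintro _ ⟨t, ⟨-, ht⟩, rfl⟩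
    rw [EReal.coe_le_coe_iff]
    by_contra hlt
    have hq' : q ∈ interior (propagation Φ t) := by
      refine interior_mono (hsub.trans (propagation_anti Φ (not_le.1 hlt).le)) ?_
      rw [Metric.isOpen_ball.interior_eq]
      exact Metric.mem_ball_self (by linarith)
    rw [ht] at hq'
    exact hq'
  rw [hT, EReal.coe_le_coe_iff] at hle
  linarith

/-- If some front is a single point, then the set is bounded: its support half-planes, and hence
all of its fronts, are invariant under its asymptotic directions. -/
lemma isBounded_of_propagation_eq_singleton {Φ : Set Plane} (hcl : IsClosed Φ) (hcv : Convex ℝ Φ)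
    (hne : Φ.Nonempty) {T : ℝ} {p : Plane} (hp : propagation Φ T = {p}) :
    Bornology.IsBounded Φ := by
  by_contra hb
  obtain ⟨u, hu, hcone⟩ := not_bounded_iff_exists_ne_zero_mem_asymptoticCone.1 hb
  obtain ⟨q, hq⟩ := hne
  have hpos : ∀ l c, IsSupport Φ l c → 0 ≤ toPlane l ⬝ᵥ u := by
    intro l c hc
    by_contra hneg
    rw [not_le] at hneg
    have hs : 0 ≤ (toPlane l ⬝ᵥ q - c + 1) / -(toPlane l ⬝ᵥ u) := by
      have : c ≤ toPlane l ⬝ᵥ q := hc.2.1 hq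
      exact div_nonneg (by linarith) (by linarith)
    have hmem := hcv.smul_vadd_mem_of_isClosed_of_mem_asymptoticCone hcl hs hcone hq
    have h1 : c ≤ toPlane l ⬝ᵥ (((toPlane l ⬝ᵥ q - c + 1) / -(toPlane l ⬝ᵥ u)) • u + q) :=
      hc.2.1 hmem
    rw [dotProduct_add, dotProduct_smul, smul_eq_mul, div_neg, neg_mul,
      div_mul_cancel₀ _ hneg.ne] at h1
    linarith
  have hmem : p + u ∈ propagation Φ T := by
    intro l c hc
    have h1 : p ∈ propagation Φ T := by rw [hp]; rfl
    have h2 : c + T ≤ toPlane l ⬝ᵥ p := h1 l c hc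
    show c + T ≤ toPlane l ⬝ᵥ (p + u)
    rw [dotProduct_add]
    have := hpos l c hc
    linarith
  rw [hp, mem_singleton_iff, add_eq_left] at hmem
  exact hu hmem

lemma exists_int_mul_abs_eq {x : ℝ} (hx : x ≠ 0) : ∃ s : ℤ, s ≠ 0 ∧ (s : ℝ) * |x| = x := by
  rcases hx.lt_or_gt with h | h
  · exact ⟨-1, by norm_num, by rw [abs_of_neg h]; push_cast; ring⟩
  · exact ⟨1, one_ne_zero, by rw [abs_of_pos h]; push_cast; ring⟩

/-- Dirichlet's approximation theorem for directions in the plane. -/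
lemma exists_lattice_near_ray {m : Plane} (hm : m ≠ 0) {e : ℝ} (he : 0 < e) :
    ∃ (l : Fin 2 → ℤ) (k : ℝ), l ≠ 0 ∧ 0 < k ∧ ∀ i, |(l i : ℝ) - k * m i| ≤ e := by
  by_cases h0 : m 0 = 0
  · have h1 : m 1 ≠ 0 := by
      intro h1
      apply hm
      ext i; fin_cases i
      · exact h0
      · exact h1
    obtain ⟨s, hs0, hs⟩ := exists_int_mul_abs_eq h1
    refine ⟨![0, s], |m 1|⁻¹, fun hz => hs0 (congrFun hz 1), inv_pos.2 (abs_pos.2 h1), fun i => ?_⟩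
    fin_cases i
    · simp [h0, he.le]
    · have h2 : (s : ℝ) - |m 1|⁻¹ * m 1 = 0 := by
        rw [sub_eq_zero, eq_inv_mul_iff_mul_eq₀ (abs_ne_zero.2 h1), mul_comm, hs]
      show |(s : ℝ) - |m 1|⁻¹ * m 1| ≤ e
      rw [h2, abs_zero]
      exact he.le
  · obtain ⟨n, hn⟩ := exists_nat_gt (1 / e)
    have hn0 : (0 : ℝ) < n := (by positivity : (0 : ℝ) < 1 / e).trans hn
    obtain ⟨j, k, hk, -, hle⟩ := Real.exists_int_int_abs_mul_sub_le (m 1 / |m 0|)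
      (n := n) (by exact_mod_cast hn0)
    have hkR : (0 : ℝ) < k := by exact_mod_cast hk
    have habs : 0 < |m 0| := abs_pos.2 h0
    obtain ⟨s, hs0, hs⟩ := exists_int_mul_abs_eq h0
    refine ⟨![s * k, j], k / |m 0|, fun hz => mul_ne_zero hs0 hk.ne' (congrFun hz 0),
      div_pos hkR habs, fun i => ?_⟩
    fin_cases i
    · have h2 : ((s * k : ℤ) : ℝ) - k / |m 0| * m 0 = 0 := by
        rw [sub_eq_zero, div_mul_eq_mul_div, eq_div_iff habs.ne']
        push_cast
        rw [mul_right_comm, hs, mul_comm]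
      show |((s * k : ℤ) : ℝ) - k / |m 0| * m 0| ≤ e
      rw [h2, abs_zero]
      exact he.le
    · show |(j : ℝ) - k / |m 0| * m 1| ≤ e
      have h3 : 1 / ((n : ℝ) + 1) ≤ e := by
        rw [div_le_iff₀ (by linarith)]
        rw [div_lt_iff₀ he] at hn
        nlinarith
      rw [abs_sub_comm]
      refine le_trans (le_of_eq ?_) (hle.trans h3)
      congr 1
      ring

section FinalPoint

variable {Φ : Set Plane} {T : ℝ} {p : Plane} (hcp : IsCompact Φ) (hcv : Convex ℝ Φ)
  (hne : Φ.Nonempty) (hT : 0 < T) (hp : propagation Φ T = {p})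

include hp in
lemma IsSupport.add_le_of_final {l : Fin 2 → ℤ} {c : ℝ} (hc : IsSupport Φ l c) :
    c + T ≤ toPlane l ⬝ᵥ p := by
  have h1 : p ∈ propagation Φ T := by rw [hp]; rfl
  exact h1 l c hc

include hcp hne hT hp in
/-- Every integral form falls, somewhere on the set, below its value at the final point, by at
least the final time. -/
lemma exists_dot_le_of_final {z : Fin 2 → ℤ} (hz : z ≠ 0) :
    ∃ q ∈ Φ, toPlane z ⬝ᵥ (q - p) ≤ -T := by
  obtain ⟨n, l, hn, hl, hzl⟩ := exists_primitive hz
  obtain ⟨c, hc⟩ := exists_isSupport hcp hne hl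
  obtain ⟨q, hq, hqc⟩ := hc.exists_mem hcp.isClosed
  refine ⟨q, hq, ?_⟩
  have h1 := hc.add_le_of_final hp
  have h2 : (1 : ℝ) ≤ n := by exact_mod_cast hn
  rw [hzl, smul_dotProduct, dotProduct_sub, hqc, smul_eq_mul]
  nlinarith

include hcp hcv hne hT hp in
/-- The final point is an interior point. A linear form that is nonnegative on `Φ - p` would be, up
to a factor, close to an integral one by Dirichlet's theorem, although all integral forms fall to
`-T` on the bounded set `Φ - p`. -/
lemma mem_interior_of_final : p ∈ interior Φ := by
  by_contra hnot
  have himg := (Homeomorph.subRight p).image_interior Φ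
  have himg' : interior ((fun x => x - p) '' Φ) = (fun x => x - p) '' interior Φ := himg.symm
  have hconv : Convex ℝ ((fun x => x - p) '' Φ) := by
    simpa only [sub_eq_add_neg, image_add_right, neg_neg] using hcv.translate_preimage_left p
  obtain ⟨m, hm, hge⟩ := exists_dot_nonneg hconv (by
    rw [himg']
    rintro ⟨x, hx, hxp⟩
    rw [sub_eq_zero.1 hxp] at hx
    exact hnot hx)
  obtain ⟨B, hB, hBle⟩ := (hcp.image (continuous_id.sub
    (continuous_const (y := p)))).isBounded.exists_pos_norm_le
  obtain ⟨l, k, hl, hk, happ⟩ := exists_lattice_near_ray hm (e := T / (4 * B)) (by positivity)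
  obtain ⟨q, hq, hqle⟩ := exists_dot_le_of_final hcp hne hT hp hl
  have h1 : 0 ≤ m ⬝ᵥ (q - p) := hge _ ⟨q, hq, rfl⟩
  have h2 : ‖q - p‖ ≤ B := hBle _ ⟨q, hq, rfl⟩
  have h3 : ∀ i, |((l i : ℝ) - k * m i) * (q - p) i| ≤ T / 4 := by
    intro i
    rw [abs_mul]
    have hi : |(q - p) i| ≤ B := (norm_le_pi_norm (q - p) i).trans h2
    calc _ ≤ T / (4 * B) * B := mul_le_mul (happ i) hi (abs_nonneg _) (by positivity)
      _ = T / 4 := by field_simp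
  have h40 := (abs_le.1 (h3 0)).1
  have h41 := (abs_le.1 (h3 1)).1
  rw [dot_eq] at h1 hqle
  simp only [toPlane_apply] at hqle
  nlinarith [mul_nonneg hk.le h1]

include hcp hcv hne hT hp in
/-- Support lines either reach the final point at the final time, or they stay away from it by an
amount that grows linearly with the slope: lines of large slope are far from an interior point,
and there are finitely many lines of small slope. -/
lemma exists_gap : ∃ e > 0, ∀ l c, IsSupport Φ l c →
    c = toPlane l ⬝ᵥ p - T ∨ c ≤ toPlane l ⬝ᵥ p - T - e * sumAbs l := by
  obtain ⟨r, hr, hball⟩ := Metric.nhds_basis_closedBall.mem_iff.1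
    (mem_interior_iff_mem_nhds.1 (mem_interior_of_final hcp hcv hne hT hp))
  have hfin := finite_sumAbs_le (2 * T / r)
  have hev : ∀ l ∈ {l : Fin 2 → ℤ | sumAbs l ≤ 2 * T / r}, ∀ᶠ e : ℝ in 𝓝 0,
      ∀ c, IsSupport Φ l c → c = toPlane l ⬝ᵥ p - T ∨
        c ≤ toPlane l ⬝ᵥ p - T - e * sumAbs l := by
    intro l _
    by_cases hex : ∃ c, IsSupport Φ l c
    · obtain ⟨c, hc⟩ := hex
      have hle := hc.add_le_of_final hp
      rcases hle.eq_or_lt with heq | hlt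
      · refine Eventually.of_forall fun e c' hc' => Or.inl ?_
        rw [hc'.unique hcp.isClosed hc]
        linarith
      · have hcont : ContinuousAt (fun e : ℝ => toPlane l ⬝ᵥ p - T - e * sumAbs l) 0 := by
          fun_prop
        filter_upwards [hcont.eventually (lt_mem_nhds (a := c) (by
          simp only [zero_mul, sub_zero]; linarith))]
          with e he c' hc'
        rw [hc'.unique hcp.isClosed hc]
        exact Or.inr he.le
    · exact Eventually.of_forall fun e c hc => absurd ⟨c, hc⟩ hex
  have hall := (hfin.eventually_all).2 hev
  have hr2 : ∀ᶠ e : ℝ in 𝓝 0, e < r / 2 := gt_mem_nhds (by linarith)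
  obtain ⟨e, ⟨h1, h2⟩, h3⟩ := (((hall.and hr2).filter_mono
    (nhdsWithin_le_nhds (s := Ioi 0))).and self_mem_nhdsWithin).exists
  refine ⟨e, h3, fun l c hc => ?_⟩
  by_cases hl : sumAbs l ≤ 2 * T / r
  · exact h1 l hl c hc
  · right
    rw [not_le, div_lt_iff₀ hr] at hl
    have h4 := hc.le_of_ball hr.le hball
    nlinarith [sumAbs_nonneg l]

/-- The slopes of the support lines that reach the final point at the final time span a reflexive
polygon, and the fronts shrink along its dual. -/
theorem exists_shrinksTo_of_final (hcp : IsCompact Φ) (hcv : Convex ℝ Φ)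
    (hne : Φ.Nonempty) (hT : 0 < T) (hp : propagation Φ T = {p}) :
    ∃ (K : Set Plane) (τ₀ : ℝ), IsReflexivePolygon K 0 ∧ ShrinksTo Φ p T τ₀ K := by
  obtain ⟨e, he, hgap⟩ := exists_gap hcp hcv hne hT hp
  set A : Set (Fin 2 → ℤ) := {l | IsSupport Φ l (toPlane l ⬝ᵥ p - T)} with hA
  have hAfin : A.Finite := by
    obtain ⟨r, hr, hball⟩ := Metric.nhds_basis_closedBall.mem_iff.1
      (mem_interior_iff_mem_nhds.1 (mem_interior_of_final hcp hcv hne hT hp))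
    refine (finite_sumAbs_le (T / r)).subset fun l hl => ?_
    have := IsSupport.le_of_ball hl hr.le hball
    rw [mem_ofPred_eq, le_div_iff₀ hr]
    linarith
  set Q := convexHull ℝ (toPlane '' A) with hQ
  have hQref : IsReflexivePolygon Q 0 := by
    refine ⟨⟨hAfin.toFinset, by rw [hAfin.coe_toFinset]⟩, ?_⟩
    have h0 : (0 : Plane) ∈ interior Q := by
      by_contra hnot
      obtain ⟨m, hm, hge⟩ := exists_dot_nonneg (convex_convexHull ℝ _) hnot
      -- The final locus would contain a segment in the direction of `m`.
      have hmn : 0 < ‖m‖ := norm_pos_iff.2 hm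
      have hmem : p + (e / ‖m‖) • m ∈ propagation Φ T := by
        intro l c hc
        show c + T ≤ toPlane l ⬝ᵥ (p + (e / ‖m‖) • m)
        rw [dotProduct_add, dotProduct_smul, smul_eq_mul]
        rcases hgap l c hc with h1 | h1
        · have hl : l ∈ A := by rw [hA, mem_ofPred_eq, ← h1]; exact hc
          have := hge _ (subset_convexHull ℝ _ ⟨l, hl, rfl⟩)
          rw [dotProduct_comm] at this
          have := mul_nonneg (div_nonneg he.le hmn.le) this
          linarith
        · have h2 := (abs_le.1 (abs_dot_le l m)).1
          have h3 : -(e * sumAbs l) ≤ e / ‖m‖ * toPlane l ⬝ᵥ m := by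
            have h4 := mul_le_mul_of_nonneg_left h2 (div_nonneg he.le hmn.le)
            have h5 : e / ‖m‖ * -(sumAbs l * ‖m‖) = -(e * sumAbs l) := by field_simp
            linarith
          linarith
      rw [hp, mem_singleton_iff, add_eq_left] at hmem
      exact smul_ne_zero (div_pos he hmn).ne' hm hmem
    ext z
    rw [mem_ofPred_eq, mem_singleton_iff]
    constructor
    · intro hz
      -- On `Q` the form `q - p` is at least `-T`, and larger than that at interior points; yet `z`
      -- attains `-T` or less at some `q` in `Φ`.
      by_contra hz0
      obtain ⟨s, hs, hmem⟩ := exists_add_smul_mem hz (toPlane z)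
      obtain ⟨q, hq, hqle⟩ := exists_dot_le_of_final hcp hne hT hp hz0
      have h1 := dot_ge_of_mem_convexHull (m := q - p) (c := -T) (by
        rintro _ ⟨l, hl, rfl⟩
        have : toPlane l ⬝ᵥ p - T ≤ toPlane l ⬝ᵥ q := hl.2.1 hq
        rw [dotProduct_comm, dotProduct_sub]
        linarith) hmem
      rw [dotProduct_comm, add_dotProduct, smul_dotProduct, smul_eq_mul] at h1
      nlinarith
    · rintro rfl
      rwa [toPlane_zero]
  have hK := hQref.dual
  obtain ⟨C, hC, hCle⟩ := hK.isCompact.isBounded.exists_pos_norm_le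
  refine ⟨dualPolygon Q 0, min T (e / C), hK, lt_min hT (div_pos he hC), min_le_left _ _,
    hK.convex, hK.isCompact, hK.zero_mem_interior, fun τ h0 h1 => ?_⟩
  rcases h0.eq_or_lt with rfl | hpos
  · rw [sub_zero, hp]
    simp only [zero_smul, zero_add]
    exact (Set.Nonempty.image_const ⟨0, interior_subset hK.zero_mem_interior⟩ p).symm
  -- Up to `τ = e / C` the support lines that do not reach `p` do not meet `p + τ K`.
  have hτC : τ * C ≤ e := (le_div_iff₀ hC).1 (h1.trans (min_le_right _ _))
  apply subset_antisymm
  · intro x hx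
    refine ⟨τ⁻¹ • (x - p), ?_, ?_⟩
    · rw [mem_dualPolygon_zero]
      intro y hy
      refine dot_ge_of_mem_convexHull ?_ hy
      rintro _ ⟨l, hl, rfl⟩
      have : toPlane l ⬝ᵥ p - T + (T - τ) ≤ toPlane l ⬝ᵥ x := hx l _ hl
      rw [smul_dotProduct, smul_eq_mul, ← mul_le_mul_iff_right₀ hpos, ← mul_assoc,
        mul_inv_cancel₀ hpos.ne', dotProduct_comm, dotProduct_sub]
      linarith
    · simp only [smul_smul, mul_inv_cancel₀ hpos.ne', one_smul, sub_add_cancel]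
  · rintro _ ⟨y, hy, rfl⟩ l c hc
    show c + (T - τ) ≤ toPlane l ⬝ᵥ (τ • y + p)
    rw [dotProduct_add, dotProduct_smul, smul_eq_mul]
    rcases hgap l c hc with h2 | h2
    · have hl : l ∈ A := by rw [hA, mem_ofPred_eq, ← h2]; exact hc
      have := mem_dualPolygon_zero.1 hy _ (subset_convexHull ℝ _ ⟨l, hl, rfl⟩)
      rw [dotProduct_comm] at this
      nlinarith
    · have h3 := (abs_le.1 ((abs_dot_le l y).trans (mul_le_mul_of_nonneg_left (hCle y hy)
        (sumAbs_nonneg l)))).1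
      nlinarith [mul_le_mul_of_nonneg_left hτC (sumAbs_nonneg l),
        mul_le_mul_of_nonneg_left h3 hpos.le]

end FinalPoint

/-- The fronts of an admissible set that shrinks to a point are finally homothetic to a reflexive
polygon. -/
lemma IsAdmissible.exists_shrinksTo {Φ : Set Plane} (hΦ : IsAdmissible Φ)
    (hint : (interior Φ).Nonempty) {p : Plane} (hp : finalLocus Φ = {p}) :
    ∃ (K : Set Plane) (T τ₀ : ℝ), IsReflexivePolygon K 0 ∧ ShrinksTo Φ p T τ₀ K := by
  obtain ⟨T, hT, -⟩ : p ∈ finalLocus Φ := by rw [hp]; rfl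
  have hprop : propagation Φ T = {p} := by
    rw [← hp]
    ext x
    simp only [finalLocus, mem_ofPred_eq, hT, EReal.coe_eq_coe_iff]
    simp
  have hne := hint.mono interior_subset
  have hcp : IsCompact Φ := Metric.isCompact_of_isClosed_isBounded hΦ.closed
    (isBounded_of_propagation_eq_singleton hΦ.closed hΦ.convex hne hprop)
  obtain ⟨K, τ₀, hK, hs⟩ := exists_shrinksTo_of_final hcp hΦ.convex hne (finalTime_pos hint hT)
    hprop
  exact ⟨K, T, τ₀, hK, hs⟩

end TropicalPlane

theorem mainTheorem11 :
    -- the caustic of any lattice polygon with a single interior lattice point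
    (∀ (P : Set Plane) (o : Fin 2 → ℤ), IsReflexivePolygon P o →
      caustic P = (⋃ v ∈ P.extremePoints ℝ, segment ℝ (toPlane o) v \ {v}) ∧
      ∀ v ∈ P.extremePoints ℝ, ∃ w : ℕ, HasTropicalLength (dualSide P (toPlane o) v) (w : ℝ) ∧
        ∀ x ∈ openSegment ℝ (toPlane o) v, ∀ w' : ℕ, HasCausticWeight P x w' ↔ w' = w) ∧
    -- there are 16 such polygons up to isomorphism, and they are the local models
    ∃ (R : Fin 16 → Set Plane) (c : Fin 16 → Fin 2 → ℤ),
      (∀ i, IsReflexivePolygon (R i) (c i)) ∧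
      (∀ i j, TropicallyIsomorphic (R i) (R j) → i = j) ∧
      (∀ (P : Set Plane) (o : Fin 2 → ℤ), IsReflexivePolygon P o →
        ∃ i, TropicallyIsomorphic P (R i)) ∧
      ∀ Φ : Set Plane, IsAdmissible Φ → (interior Φ).Nonempty →
        ∀ p : Plane, finalLocus Φ = {p} →
          IsGraphVertex (caustic Φ) p ∧
          ∃ i, CausticsLocallyIsomorphic Φ p (R i) (toPlane (c i)) := by
  refine ⟨fun P o h => ⟨h.caustic_eq, fun v hv => h.exists_caustic_weight hv⟩,
    model, fun _ => 0, isReflexivePolygon_model, fun i j => model_injective, ?_, ?_⟩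
  · intro P o h
    obtain ⟨i, g, hg⟩ := h.center.exists_model
    refine ⟨i, fun x => linMap g x + linMap g (-toPlane o), ⟨g, _, fun x => rfl⟩, ?_⟩
    rw [← hg, image_image]
    simp only [← map_add, ← sub_eq_add_neg]
  · intro Φ hΦ hint p hp
    obtain ⟨K, T, τ₀, hK, hs⟩ := hΦ.exists_shrinksTo hint hp
    obtain ⟨i, g, hg⟩ := hK.exists_model
    refine ⟨hs.isGraphVertex, i, hs.causticsLocallyIsomorphic g (T' := 1) (τ₁ := 1) ?_⟩
    have := (isReflexivePolygon_model i).shrinksTo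
    rw [hg]
    simpa using this
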